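/- Let $\mathcal{L}=\langle\mathcal{S},\mathcal{P},\mathcal{R}\rangle$ be a finite average-reward linearly-solvable MDP with passive dynamics $\mathcal{P}(\cdot\mid s)$ and rewards $\mathcal{R}:\mathcal{S}\to\mathbb{R}$, and let $\eta>0$. A policy $\pi$ assigns to each state $s$ a distribution $\pi(\cdot\mid s)$ that is absolutely continuous with respect to $\mathcal{P}(\cdot\mid s)$; a transition $s\to s'$ under $\pi$ earns $\mathcal{R}(s)-\frac1\eta\log\frac{\pi(s'\mid s)}{\mathcal{P}(s'\mid s)}$. Assume that $\mathcal{L}$ is communicating: for all $s,s'$ some policy reaches $s'$ from $s$ with positive probability. Let $\{\mathcal{S}_i\}$ be a partition of $\mathcal{S}$, let $\mathcal{T}_i$ be the set of states outside $\mathcal{S}_i$ that are reachable in one step from $\mathcal{S}_i$ under $\mathcal{P}$, let $\mathcal{E}=\bigcup_i\mathcal{T}_i$ be the set of exit states, and let $s^*\in\mathcal{E}$ be a reference state. Let the subtasks be grouped into classes of equivalent subtasks, each with a representative (subtasks $i,j$ are equivalent if a map sending $\mathcal{S}_i$ bijectively onto $\mathcal{S}_j$ and $\mathcal{T}_i$ bijectively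 onto $\mathcal{T}_j$ preserves the rewards and transition probabilities of non-terminal states). For $\widehat\Gamma=e^{\eta\hat\rho}>0$ and $\tau\in\mathcal{T}_i$, the base LMDP $\mathcal{L}_i^\tau$ is the first-exit problem $$z_i^\tau(s)=e^{\eta(\mathcal{R}(s)-\hat\rho)}\sum_{s'}\mathcal{P}(s'\mid s)z_i^\tau(s')\quad(s\in\mathcal{S}_i),\qquad z_i^\tau(\tau)=1,\quad z_i^\tau(\tau')=0\ (\tau'\in\mathcal{T}_i\setminus\{\tau\}),$$ with $z_i^\tau\ge 0$. It is solved for the class representatives only and transported to the other subtasks by the equivalences. Let $G_\mathcal{E}(s,\tau)=z_i^\tau(s)$ if $s\in\mathcal{E}\cap\mathcal{S}_i$ and $\tau\in\mathcal{T}_i$, and $G_\mathcal{E}(s,\tau)=0$ otherwise. Algorithm (eigenvector approach), with input $\epsilon>0$ and an upper bound $h$ of the search interval: set $\mathrm{lo}=0$ and $\mathrm{hi}=h$. While $\mathrm{hi}-\mathrm{lo}>\epsilon$: let $\widehat\Gamma=(\mathrm{hi}+\mathrm{lo})/2$; solve all base LMDPs of the class representatives; solve, for $\hat z_\mathcal{E}\ge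 0$, the system $\hat z_\mathcal{E}(\tau)=(G_\mathcal{E}\hat z_\mathcal{E})(\tau)$ for $\tau\in\mathcal{E}\setminus\{s^*\}$, $\hat z_\mathcal{E}(s^*)=1$; put $\hat z(s)=\hat z_\mathcal{E}(s)$ for $s\in\mathcal{E}$ and $\hat z(s)=\sum_{\tau\in\mathcal{T}_i}\hat z_\mathcal{E}(\tau)z_i^\tau(s)$ for $s\in\mathcal{S}_i\setminus\mathcal{E}$. If all these solutions exist and are unique, and $\widehat\Gamma\hat z(s^*)>e^{\eta\mathcal{R}(s^*)}\sum_s\mathcal{P}(s\mid s^*)\hat z(s)$, set $\mathrm{hi}=\widehat\Gamma$; otherwise set $\mathrm{lo}=\widehat\Gamma$. Finally, return what the last iteration computed: $\widehat\Gamma$, the base value functions and $\hat z_\mathcal{E}$. Theorem 2. The optimal gain $\rho$ (the largest expected average reward of a policy, the same from every initial state) exists, and there is exactly one optimal value function $z>0$ with $z(s^*)=1$ and $z(s)=e^{\eta(\mathcal{R}(s)-\rho)}\sum_{s'}\mathcal{P}(s'\mid s)z(s')$ for all $s$. Put $\Gamma=e^{\eta\rho}$ and let $h\ge\Gamma$ (for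 instance $h=1$ if $\Gamma\le1$). Then for every $\epsilon>0$ the algorithm halts, with $\mathrm{lo}\le\Gamma\le\mathrm{hi}$ and $\mathrm{hi}-\mathrm{lo}\le\epsilon$. For all sufficiently small $\epsilon>0$ its last iteration has unique solutions, and as $\epsilon\to0$ the output converges to the optimal value function of $\mathcal{L}$: $\widehat\Gamma\to\Gamma$, $\hat z_\mathcal{E}(\tau)\to z(\tau)$ for every $\tau\in\mathcal{E}$, and $\sum_{\tau\in\mathcal{T}_i}\hat z_\mathcal{E}(\tau)z_i^\tau(s)\to z(s)$ for every $i$ and every $s\in\mathcal{S}_i$. -/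

import Mathlib

open Filter Topology

/-- An average-reward linearly-solvable Markov decision process on a finite state space `S`:
passive dynamics `P` (`P s s'` is the probability of moving from `s` to `s'`) and rewards `R`. -/
structure ALMDP (S : Type*) [Fintype S] where
  P : Matrix S S ℝ
  P_nonneg : ∀ s s', 0 ≤ P s s'
  P_sum : ∀ s, ∑ s', P s s' = 1
  R : S → ℝ

namespace ALMDP

variable {S : Type*} [Fintype S]

/-- Stationary policies. A policy has to be absolutely continuous with respect to the passive
dynamics, since otherwise the control cost `log (π / P)` is infinite. -/
structure IsPolicy (L : ALMDP S) (π : Matrix S S ℝ) : Prop where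
  nonneg : ∀ s s', 0 ≤ π s s'
  sum_eq_one : ∀ s, ∑ s', π s s' = 1
  abs_cont : ∀ s s', L.P s s' = 0 → π s s' = 0

/-- Every state can be reached from every state under some policy. -/
def Communicating [DecidableEq S] (L : ALMDP S) : Prop :=
  ∀ s s', ∃ π, L.IsPolicy π ∧ ∃ n : ℕ, 0 < (π ^ n) s s'

/-- The (mean) reward of the transition `s → s'` under the policy `π`. -/
noncomputable def reward (L : ALMDP S) (η : ℝ) (π : Matrix S S ℝ) (s s' : S) : ℝ :=
  L.R s - (1 / η) * Real.log (π s s' / L.P s s')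

/-- The expectation of the reward `reward η π S_t S_{t+1}` under `π` when `S_0 = s`. -/
noncomputable def expectedReward [DecidableEq S] (L : ALMDP S) (η : ℝ) (π : Matrix S S ℝ)
    (s : S) (t : ℕ) : ℝ :=
  ∑ x, ∑ y, (π ^ t) s x * π x y * L.reward η π x y

/-- The expected average reward of `π` from the state `s` exists and equals `g`. -/
def HasGain [DecidableEq S] (L : ALMDP S) (η : ℝ) (π : Matrix S S ℝ) (s : S) (g : ℝ) : Prop :=
  Tendsto (fun T : ℕ => (1 / (T : ℝ)) * ∑ t ∈ Finset.range (T + 1), L.expectedReward η π s t)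
    atTop (𝓝 g)

/-- `ρ` is the optimal gain: from every state it is the largest average reward of a policy. -/
def IsOptimalGain [DecidableEq S] (L : ALMDP S) (η ρ : ℝ) : Prop :=
  ∀ s, IsGreatest {g : ℝ | ∃ π, L.IsPolicy π ∧ L.HasGain η π s g} ρ

/-- `z = exp (η v)` solves the exponentiated Bellman optimality equation for the gain `ρ` and is
normalized by `z sRef = 1` at the reference state. -/
structure IsOptimalValue (L : ALMDP S) (η ρ : ℝ) (sRef : S) (z : S → ℝ) : Prop where
  pos : ∀ s, 0 < z s
  ref : z sRef = 1
  bellman : ∀ s, z s = Real.exp (η * (L.R s - ρ)) * ∑ s', L.P s s' * z s'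

/-- `z` solves the Bellman optimality equation of the first-exit problem with non-terminal
states `N`, the dynamics `P`, the rewards `r` on `N`, and the exponentiated terminal values `b`
outside `N`. As `z` stands for `exp (η v)` with `v ∈ [-∞, ∞)`, it is nonnegative. States outside
`N` that cannot be reached in one step from `N` just carry the value `b`. -/
structure IsFirstExitSolution (L : ALMDP S) (η : ℝ) (N : Set S) (r b z : S → ℝ) : Prop where
  nonneg : ∀ s, 0 ≤ z s
  terminal : ∀ s, s ∉ N → z s = b s
  bellman : ∀ s, s ∈ N → z s = Real.exp (η * r s) * ∑ s', L.P s s' * z s'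

variable {ι : Type*}

/-- The block `S_i` of the partition into the fibres of `part`. -/
def block (part : S → ι) (i : ι) : Set S := {s | part s = i}

/-- The terminal states `T_i` of the subtask on the block `S_i`. -/
def terminals (L : ALMDP S) (part : S → ι) (i : ι) : Set S :=
  {τ | τ ∉ block part i ∧ ∃ s ∈ block part i, 0 < L.P s τ}

/-- `f` is an equivalence between the subtasks `i` and `j`: a bijection between their
non-terminal states and between their terminal states that preserves rewards and transition
probabilities of non-terminal states. -/
structure IsSubtaskEquiv (L : ALMDP S) (part : S → ι) (i j : ι) (f : S → S) : Prop where
  block_bij : Set.BijOn f (block part i) (block part j)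
  terminals_bij : Set.BijOn f (L.terminals part i) (L.terminals part j)
  reward_eq : ∀ s ∈ block part i, L.R (f s) = L.R s
  prob_eq : ∀ s ∈ block part i, ∀ s' ∈ block part i ∪ L.terminals part i,
    L.P (f s) (f s') = L.P s s'

/-- A hierarchical decomposition: a partition of the state space into blocks (the fibres of
`part`), and a grouping of the subtasks into classes of equivalent subtasks. The class of `i` is
represented by the subtask `rep i`, and `toRep i` is the equivalence from `i` to `rep i`. -/
structure Decomposition (L : ALMDP S) (ι : Type*) where
  part : S → ι
  rep : ι → ι
  rep_rep : ∀ i, rep (rep i) = rep i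
  toRep : ι → S → S
  equiv : ∀ i, L.IsSubtaskEquiv part i (rep i) (toRep i)

namespace Decomposition

variable {L : ALMDP S}

/-- The terminal states `T_i` of the subtask `i`. -/
def T (D : Decomposition L ι) (i : ι) : Set S := L.terminals D.part i

/-- The exit states: the union of all `T_i`. -/
def exits (D : Decomposition L ι) : Set S := ⋃ i, D.T i

theorem mem_exits (D : Decomposition L ι) {i : ι} {τ : S} (h : τ ∈ D.T i) : τ ∈ D.exits :=
  Set.mem_iUnion.2 ⟨i, h⟩

open scoped Classical in
/-- `z` is a solution of the base LMDP of the subtask `j` and its terminal state `τ`, for the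
exponentiated gain estimate `Γ`: the rewards are `R - log Γ / η`, and the (exponentiated) terminal
value is `1` at `τ` and `0` elsewhere. -/
def IsBaseSolution (D : Decomposition L ι) (η Γ : ℝ) (j : ι) (τ : S) (z : S → ℝ) : Prop :=
  L.IsFirstExitSolution η (block D.part j) (fun s => L.R s - Real.log Γ / η)
    (fun s => if s = τ then 1 else 0) z

/-- The solution of the base LMDP of `j` and `τ` (meaningful only where it exists uniquely). -/
noncomputable def baseSolution (D : Decomposition L ι) (η Γ : ℝ) (j : ι) (τ : S) : S → ℝ :=
  Classical.epsilon (D.IsBaseSolution η Γ j τ)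

/-- What an iteration of the algorithm computes: the gain estimate, the value functions
`base j τ` of the base LMDPs (for the class representatives `j` and `τ ∈ T_j`; no other value is
ever used), and the values of the exit states. -/
structure Estimate (D : Decomposition L ι) where
  gain : ℝ
  base : ι → S → S → ℝ
  zE : D.exits → ℝ

open scoped Classical in
/-- The value of `s ∈ S_i` composed from the values of the terminal states of its subtask:
`∑_{τ ∈ T_i} zE τ * z_i^τ s`, where `z_i^τ` is read off from the class representative. -/
noncomputable def Estimate.compose {D : Decomposition L ι} (e : D.Estimate) (s : S) : ℝ :=
  ∑ τ : D.T (D.part s), e.zE ⟨τ.1, D.mem_exits τ.2⟩ *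
    e.base (D.rep (D.part s)) (D.toRep (D.part s) τ.1) (D.toRep (D.part s) s)

open scoped Classical in
/-- The estimate of the value of an arbitrary state: stored for exits, composed otherwise. -/
noncomputable def Estimate.value {D : Decomposition L ι} (e : D.Estimate) (s : S) : ℝ :=
  if h : s ∈ D.exits then e.zE ⟨s, h⟩ else e.compose s

open scoped Classical in
/-- The matrix `G_E` on the exit states for the exponentiated gain estimate `Γ`. -/
noncomputable def G (D : Decomposition L ι) (η Γ : ℝ) : Matrix D.exits D.exits ℝ :=
  fun s s' =>
    if s'.1 ∈ D.T (D.part s.1) then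
      D.baseSolution η Γ (D.rep (D.part s.1)) (D.toRep (D.part s.1) s'.1)
        (D.toRep (D.part s.1) s.1)
    else 0

open scoped Classical in
/-- `w` solves `z_E = G_E z_E` on the non-terminal exits of the first-exit problem in which the
reference state is made terminal with the value `1`. -/
structure IsExitSolution (D : Decomposition L ι) (η : ℝ) (sRef : S) (Γ : ℝ)
    (w : D.exits → ℝ) : Prop where
  nonneg : ∀ s, 0 ≤ w s
  ref : ∀ s : D.exits, s.1 = sRef → w s = 1
  eq : ∀ s : D.exits, s.1 ≠ sRef → w s = (D.G η Γ).mulVec w s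

/-- The base LMDPs of all equivalence classes, and the system on the exit states, have unique
solutions for the exponentiated gain estimate `Γ`. -/
def Solvable (D : Decomposition L ι) (η : ℝ) (sRef : S) (Γ : ℝ) : Prop :=
  (∀ j ∈ Set.range D.rep, ∀ τ ∈ D.T j, ∃! z, D.IsBaseSolution η Γ j τ z) ∧
    ∃! w, D.IsExitSolution η sRef Γ w

/-- The solutions computed for the exponentiated gain estimate `Γ`. -/
noncomputable def solve (D : Decomposition L ι) (η : ℝ) (sRef : S) (Γ : ℝ) : D.Estimate where
  gain := Γ
  base := D.baseSolution η Γ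
  zE := Classical.epsilon (D.IsExitSolution η sRef Γ)

/-- The test `Γ z(s*) > exp (η R(s*)) ∑ s, P(s | s*) z(s)` of the binary search. -/
def TooLarge {D : Decomposition L ι} (η : ℝ) (sRef : S) (e : D.Estimate) : Prop :=
  e.gain * e.value sRef > Real.exp (η * L.R sRef) * ∑ s, L.P sRef s * e.value s

/-- The state of the algorithm: the search interval, and what the last iteration computed
(`none` before the first iteration, and if the last iteration found no unique solution). -/
structure State (D : Decomposition L ι) where
  lo : ℝ
  hi : ℝ
  est : Option D.Estimate

open scoped Classical in
/-- The body of the loop. If a system has no unique solution, the gain estimate is too small. -/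
noncomputable def step (D : Decomposition L ι) (η : ℝ) (sRef : S) (σ : D.State) : D.State :=
  let Γ := (σ.hi + σ.lo) / 2
  if D.Solvable η sRef Γ then
    if TooLarge η sRef (D.solve η sRef Γ) then ⟨σ.lo, Γ, some (D.solve η sRef Γ)⟩
    else ⟨Γ, σ.hi, some (D.solve η sRef Γ)⟩
  else ⟨Γ, σ.hi, none⟩

/-- `Loop η sRef ε σ σ'`: the loop `while hi - lo > ε` entered in state `σ` halts in `σ'`. -/
inductive Loop (D : Decomposition L ι) (η : ℝ) (sRef : S) (ε : ℝ) : D.State → D.State → Prop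
  | halt (σ : D.State) : ¬ (σ.hi - σ.lo > ε) → Loop D η sRef ε σ σ
  | next (σ σ' : D.State) : σ.hi - σ.lo > ε → Loop D η sRef ε (D.step η sRef σ) σ' →
      Loop D η sRef ε σ σ'

/-- The eigenvector approach with the initial search interval `[0, h]` and the accuracy `ε`
halts in the state `σ`. -/
def HaltsIn (D : Decomposition L ι) (η : ℝ) (sRef : S) (h ε : ℝ) (σ : D.State) : Prop :=
  D.Loop η sRef ε ⟨0, h, none⟩ σ

/-- The eigenvector approach halts and returns the estimate `e`. -/
def Returns (D : Decomposition L ι) (η : ℝ) (sRef : S) (h ε : ℝ) (e : D.Estimate) : Prop :=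
  ∃ σ, D.HaltsIn η sRef h ε σ ∧ σ.est = some e

end Decomposition

end ALMDP

/-! Let K be the matrix exp(η R s) P(s' | s) (`kernel`). The Bellman equation is then K z = Γ z with
Γ = exp(η ρ). Communication makes K irreducible, so K has positive right and left eigenvectors z and
y for one eigenvalue Γ (`Communicating.exists_eigenvectors`). Its ρ is the optimal gain: log x ≤ x -
1 bounds the one-step reward of every policy, the greedy policy attains the bound, and the value
terms telescope (`IsOptimalValue.isOptimalGain`).

By superposition, the base LMDPs and the exit system at an estimate g amount to one linear problem g
u = K' u + k (`CutBellman`). Here k collects the transitions into s* from other blocks and K' is K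
without them: s* is terminal with value 1 when entered from outside, but an ordinary state for its
own block. As s* is an exit, some entry of K' is strictly below that of K, and irreducibility yields
v > 0 with K' v < Γ v (`exists_supersolution`). The same v serves for g ≥ Γ and for g near Γ, where
a maximum principle gives unique nonnegative solutions of all systems. At g = Γ the solution is z,
and the resolvent is continuous there, so the outputs converge once g → Γ.

The test is decided by duality. Pairing the cut equation with y gives (g - Γ)⟨y, u⟩ = (1 - u(s*))⟨y,
k⟩ with u ≥ 0 and ⟨y, k⟩ > 0, so u(s*) < 1 exactly when g > Γ. The test amounts to (g - K(s*, s*))(1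
- u(s*)) > 0, and K(s*, s*) ≤ Γ (`Solvable.tooLarge_iff_lt`). This needs only solvability at g, so
it also covers g < Γ; and if solvability fails, then g < Γ. Hence bisection always keeps Γ in the
interval. -/

namespace Matrix

/-! ### Nonnegative matrices: Perron–Frobenius, maximum principle, strict supersolutions. -/

variable {n : Type*} [Fintype n]

theorem mulVec_nonneg_of_nonneg {A : Matrix n n ℝ} (hA : ∀ i j, 0 ≤ A i j) {x : n → ℝ}
    (hx : ∀ i, 0 ≤ x i) (i : n) : 0 ≤ (A *ᵥ x) i :=
  Finset.sum_nonneg fun j _ => mul_nonneg (hA i j) (hx j)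

theorem mulVec_mono_of_nonneg {A : Matrix n n ℝ} (hA : ∀ i j, 0 ≤ A i j) {x y : n → ℝ}
    (hxy : ∀ i, x i ≤ y i) (i : n) : (A *ᵥ x) i ≤ (A *ᵥ y) i :=
  Finset.sum_le_sum fun j _ => mul_le_mul_of_nonneg_left (hxy j) (hA i j)

theorem mulVec_pos_of_pos {A : Matrix n n ℝ} (hA : ∀ i j, 0 < A i j) {x : n → ℝ}
    (hx : ∀ i, 0 ≤ x i) {j : n} (hj : 0 < x j) (i : n) : 0 < (A *ᵥ x) i :=
  Finset.sum_pos' (fun k _ => mul_nonneg (hA i k).le (hx k))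
    ⟨j, Finset.mem_univ j, mul_pos (hA i j) hj⟩

/-- Only the support matters for the existence of paths. This carries reachability under a policy
over to the reward-weighted kernel. -/
theorem pow_apply_pos_of_support [DecidableEq n] {A B : Matrix n n ℝ} (hA : ∀ i j, 0 ≤ A i j)
    (hB : ∀ i j, 0 ≤ B i j) (h : ∀ i j, 0 < A i j → 0 < B i j) (k : ℕ) :
    ∀ i j, 0 < (A ^ k) i j → 0 < (B ^ k) i j := by
  induction k with
  | zero => intro i j hij; simpa using hij
  | succ k ih =>
    intro i j hij
    rw [pow_succ, mul_apply] at hij ⊢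
    obtain ⟨l, -, hl⟩ := Finset.exists_lt_of_sum_lt (s := Finset.univ) (f := fun _ => (0 : ℝ))
      (by simpa using hij)
    have h1 : 0 < (A ^ k) i l :=
      (pow_apply_nonneg hA k i l).lt_of_ne fun h0 => by simp [← h0] at hl
    have h2 : 0 < A l j := (hA l j).lt_of_ne fun h0 => by simp [← h0] at hl
    exact Finset.sum_pos' (fun m _ => mul_nonneg (pow_apply_nonneg hB k i m) (hB m j))
      ⟨l, Finset.mem_univ l, mul_pos (ih i l h1) (h l j h2)⟩

/-- A power sum of an irreducible nonnegative matrix is positive. -/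
theorem exists_sum_pow_pos [DecidableEq n] {A : Matrix n n ℝ} (hA : ∀ i j, 0 ≤ A i j)
    (hirr : ∀ i j, ∃ k, 0 < (A ^ k) i j) :
    ∃ N, ∀ i j, 0 < (∑ k ∈ Finset.range N, A ^ k) i j := by
  choose k hk using hirr
  refine ⟨(Finset.univ.sup fun p : n × n => k p.1 p.2) + 1, fun i j => ?_⟩
  rw [Matrix.sum_apply]
  refine Finset.sum_pos' (fun m _ => pow_apply_nonneg hA m i j)
    ⟨k i j, Finset.mem_range_succ_iff.2 ?_, hk i j⟩
  exact Finset.le_sup (f := fun p : n × n => k p.1 p.2) (Finset.mem_univ (i, j))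

/-- The existence part of the Perron–Frobenius theorem. -/
theorem exists_pos_eigenvector [DecidableEq n] [Nonempty n] {A : Matrix n n ℝ}
    (hA : ∀ i j, 0 ≤ A i j) (hirr : ∀ i j, ∃ k, 0 < (A ^ k) i j) :
    ∃ (r : ℝ) (x : n → ℝ), (∀ i, 0 < x i) ∧ ∀ i, (A *ᵥ x) i = r * x i := by
  obtain ⟨N, hN⟩ := exists_sum_pow_pos hA hirr
  set Q := ∑ k ∈ Finset.range N, A ^ k with hQ
  have hcomm : A * Q = Q * A := by
    rw [hQ, Finset.mul_sum, Finset.sum_mul]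
    exact Finset.sum_congr rfl fun k _ => (pow_mul_comm' A k).symm
  have hcomm' : ∀ x, A *ᵥ (Q *ᵥ x) = Q *ᵥ (A *ᵥ x) := fun x => by
    rw [mulVec_mulVec, hcomm, ← mulVec_mulVec]
  have hpos : ∀ x ∈ stdSimplex ℝ n, ∀ i, 0 < (Q *ᵥ x) i := by
    intro x hx
    obtain ⟨j, -, hj⟩ := Finset.exists_lt_of_sum_lt (s := Finset.univ) (f := fun _ : n => (0 : ℝ))
      (g := x) (by simp [hx.2])
    exact mulVec_pos_of_pos hN hx.1 hj
  -- The Collatz–Wielandt quotient, evaluated at `Q *ᵥ x` rather than at `x`: as `Q` is positive,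
  -- the denominators do not vanish on the boundary of the simplex.
  let f : (n → ℝ) → ℝ := fun x => Finset.univ.inf' Finset.univ_nonempty
    fun i => (A *ᵥ (Q *ᵥ x)) i / (Q *ᵥ x) i
  have hf : ContinuousOn f (stdSimplex ℝ n) := by
    refine ContinuousOn.finset_inf'_apply _ fun i _ => ContinuousOn.div ?_ ?_ fun x hx =>
      (hpos x hx i).ne'
    · exact ((continuous_apply i).comp (Continuous.matrix_mulVec continuous_const
        (Continuous.matrix_mulVec continuous_const continuous_id))).continuousOn
    · exact ((continuous_apply i).comp
        (Continuous.matrix_mulVec continuous_const continuous_id)).continuousOn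
  obtain ⟨x, hx, hmax⟩ := (isCompact_stdSimplex ℝ n).exists_isMaxOn
    ⟨_, single_mem_stdSimplex ℝ (Classical.arbitrary n)⟩ hf
  set u := Q *ᵥ x with hu
  have hupos : ∀ i, 0 < u i := hpos x hx
  have hle : ∀ i, f x * u i ≤ (A *ᵥ u) i := fun i => by
    rw [← le_div_iff₀ (hupos i)]
    exact Finset.inf'_le (fun i => (A *ᵥ (Q *ᵥ x)) i / (Q *ᵥ x) i) (Finset.mem_univ i)
  refine ⟨f x, u, hupos, ?_⟩
  by_contra! hne
  obtain ⟨j, hj⟩ := hne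
  have hs : 0 < ∑ i, u i := Finset.sum_pos (fun i _ => hupos i) Finset.univ_nonempty
  have hy : (∑ i, u i)⁻¹ • u ∈ stdSimplex ℝ n :=
    ⟨fun i => mul_nonneg (inv_nonneg.2 hs.le) (hupos i).le, by
      simp [← Finset.mul_sum, inv_mul_cancel₀ hs.ne']⟩
  -- If `A u - f x • u ≥ 0` is nonzero, then `Q` makes it positive everywhere. Since `Q` commutes
  -- with `A`, the normalized `u` then beats the maximizer `x`.
  have hlt : f x < f ((∑ i, u i)⁻¹ • u) := by
    refine (Finset.lt_inf'_iff _).2 fun i _ => ?_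
    rw [lt_div_iff₀ (hpos _ hy i)]
    have h1 : 0 < (Q *ᵥ (A *ᵥ u - f x • u)) i := by
      refine mulVec_pos_of_pos hN (fun i => ?_) (j := j) ?_ i
      · simpa using hle i
      · simpa using (hle j).lt_of_ne hj.symm
    rw [mulVec_sub, mulVec_smul, Pi.sub_apply, ← hcomm', Pi.smul_apply, smul_eq_mul] at h1
    simp only [mulVec_smul, Pi.smul_apply, smul_eq_mul]
    nlinarith [mul_pos (inv_pos.2 hs) h1]
  exact absurd (hmax hy) (not_le.2 hlt)

/-- A nonnegative matrix with a strict positive supersolution satisfies a maximum principle. -/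
theorem nonneg_of_supersolution {A : Matrix n n ℝ} (hA : ∀ i j, 0 ≤ A i j) {v : n → ℝ}
    (hv : ∀ i, 0 < v i) {c : ℝ} (hAv : ∀ i, (A *ᵥ v) i < c * v i) {x : n → ℝ}
    (hx : ∀ i, (A *ᵥ x) i ≤ c * x i) (i : n) : 0 ≤ x i := by
  by_contra! hi
  have : Nonempty n := ⟨i⟩
  -- At the minimizer `j` of `x / v`, with minimum m < 0, x ≥ m v gives (A x) j ≥ m (A v) j > m c v
  -- j = c x j.
  obtain ⟨j, hj⟩ := Finite.exists_min fun i => x i / v i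
  have hm : x j / v j < 0 := (hj i).trans_lt (div_neg_of_neg_of_pos hi (hv i))
  have h1 : (A *ᵥ ((x j / v j) • v)) j ≤ (A *ᵥ x) j := by
    refine mulVec_mono_of_nonneg hA (fun k => ?_) j
    simpa using (le_div_iff₀ (hv k)).1 (hj k)
  rw [mulVec_smul, Pi.smul_apply, smul_eq_mul] at h1
  have h2 := mul_lt_mul_of_neg_left (hAv j) hm
  have h3 : x j / v j * (c * v j) = c * x j := by
    field_simp [(hv j).ne']
  linarith [hx j]

theorem isUnit_det_of_supersolution [DecidableEq n] {A : Matrix n n ℝ} (hA : ∀ i j, 0 ≤ A i j)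
    {v : n → ℝ} (hv : ∀ i, 0 < v i) {c : ℝ} (hAv : ∀ i, (A *ᵥ v) i < c * v i) :
    IsUnit (c • (1 : Matrix n n ℝ) - A).det := by
  rw [← isUnit_iff_isUnit_det, ← mulVec_injective_iff_isUnit]
  have key : ∀ x y : n → ℝ, (c • (1 : Matrix n n ℝ) - A) *ᵥ x = (c • (1 : Matrix n n ℝ) - A) *ᵥ y →
      ∀ i, y i ≤ x i := by
    intro x y hxy i
    rw [← sub_nonneg, ← Pi.sub_apply]
    refine nonneg_of_supersolution hA hv hAv (fun i => le_of_eq ?_) i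
    have := congrFun hxy i
    simp only [sub_mulVec, smul_mulVec, one_mulVec, Pi.sub_apply, Pi.smul_apply,
      smul_eq_mul] at this
    rw [mulVec_sub, Pi.sub_apply, Pi.sub_apply]
    linarith
  exact fun x y hxy => funext fun i => le_antisymm (key y x hxy.symm i) (key x y hxy i)

theorem resolvent_eq_iff [DecidableEq n] {A : Matrix n n ℝ} {c : ℝ}
    (h : IsUnit (c • (1 : Matrix n n ℝ) - A).det) (b x : n → ℝ) :
    (∀ i, c * x i = (A *ᵥ x) i + b i) ↔ x = (c • (1 : Matrix n n ℝ) - A)⁻¹ *ᵥ b := by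
  have h1 : (∀ i, c * x i = (A *ᵥ x) i + b i) ↔ (c • (1 : Matrix n n ℝ) - A) *ᵥ x = b := by
    rw [funext_iff]
    refine forall_congr' fun i => ?_
    simp only [sub_mulVec, smul_mulVec, one_mulVec, Pi.sub_apply, Pi.smul_apply, smul_eq_mul]
    rw [sub_eq_iff_eq_add, add_comm]
  rw [h1]
  constructor
  · rintro rfl
    rw [mulVec_mulVec, nonsing_inv_mul _ h, one_mulVec]
  · rintro rfl
    rw [mulVec_mulVec, mul_nonsing_inv _ h, one_mulVec]

theorem continuousAt_resolvent_mulVec [DecidableEq n] {A : Matrix n n ℝ} {c : ℝ}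
    (h : IsUnit (c • (1 : Matrix n n ℝ) - A).det) (b : n → ℝ) :
    ContinuousAt (fun t : ℝ => (t • (1 : Matrix n n ℝ) - A)⁻¹ *ᵥ b) c := by
  have h1 : ContinuousAt (fun t : ℝ => (t • (1 : Matrix n n ℝ) - A)⁻¹) c := by
    refine ContinuousAt.comp (g := Inv.inv) (f := fun t : ℝ => t • (1 : Matrix n n ℝ) - A) ?_
      (by fun_prop)
    refine continuousAt_matrix_inv _ ?_
    rw [show (Ring.inverse : ℝ → ℝ) = Inv.inv from Ring.inverse_eq_inv']
    exact continuousAt_inv₀ h.ne_zero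
  exact ContinuousAt.comp (g := fun M : Matrix n n ℝ => M *ᵥ b)
    (Continuous.matrix_mulVec continuous_id continuous_const).continuousAt h1

/-- If `A` arises from an irreducible nonnegative matrix `H` with the positive eigenvector `z` by
decreasing some entries, one of them strictly, then `A` has a strict supersolution. -/
theorem exists_supersolution [DecidableEq n] {A H : Matrix n n ℝ} (hA : ∀ i j, 0 ≤ A i j)
    (hAH : ∀ i j, A i j ≤ H i j) (hirr : ∀ i j, ∃ k, 0 < (H ^ k) i j) {r : ℝ} (hr : 0 < r)
    {z : n → ℝ} (hz : ∀ i, 0 < z i) (hHz : ∀ i, (H *ᵥ z) i = r * z i) {a b : n}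
    (hab : A a b < H a b) :
    ∃ v : n → ℝ, (∀ i, 0 < v i) ∧ ∀ i, (A *ᵥ v) i < r * v i := by
  have hH : ∀ i j, 0 ≤ H i j := fun i j => (hA i j).trans (hAH i j)
  set B : Matrix n n ℝ := r⁻¹ • A with hB
  have hB0 : ∀ i j, 0 ≤ B i j := fun i j => mul_nonneg (inv_nonneg.2 hr.le) (hA i j)
  have hBA : ∀ x i, (B *ᵥ x) i = r⁻¹ * (A *ᵥ x) i := fun x i => by
    rw [hB, smul_mulVec, Pi.smul_apply, smul_eq_mul]
  have hAz : ∀ i, (A *ᵥ z) i ≤ r * z i := fun i => by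
    rw [← hHz i]
    exact Finset.sum_le_sum fun j _ => mul_le_mul_of_nonneg_right (hAH i j) (hz j).le
  have hBz : ∀ i, (B *ᵥ z) i ≤ z i := fun i => by
    rw [hBA, inv_mul_le_iff₀ hr]
    exact hAz i
  have hsucc : ∀ k i, ((B ^ (k + 1)) *ᵥ z) i ≤ ((B ^ k) *ᵥ z) i := fun k i => by
    rw [pow_succ, ← mulVec_mulVec]
    exact mulVec_mono_of_nonneg (pow_apply_nonneg hB0 k) hBz i
  have hanti : ∀ i, Antitone fun k => ((B ^ k) *ᵥ z) i := fun i =>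
    antitone_nat_of_succ_le fun k => hsucc k i
  have hz1 : ∀ k i, ((B ^ k) *ᵥ z) i ≤ z i := fun k i => by
    simpa using hanti i (Nat.zero_le k)
  -- The strict loss in row `a` spreads backwards along the paths of `H`. Where `A` has lost an edge
  -- of `H`, that edge itself yields strictness, because `z` is positive.
  have hstrict : ∀ k i, 0 < (H ^ k) i a → ((B ^ (k + 1)) *ᵥ z) i < z i := by
    intro k
    induction k with
    | zero =>
      intro i hi
      have hia : i = a := by
        by_contra hne
        simp [hne] at hi
      subst hia
      rw [zero_add, pow_one, hBA, inv_mul_lt_iff₀ hr, ← hHz i]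
      exact Finset.sum_lt_sum (fun j _ => mul_le_mul_of_nonneg_right (hAH i j) (hz j).le)
        ⟨b, Finset.mem_univ b, mul_lt_mul_of_pos_right hab (hz b)⟩
    | succ k ih =>
      intro i hi
      rw [pow_succ', mul_apply] at hi
      obtain ⟨l, -, hl⟩ := Finset.exists_lt_of_sum_lt (s := Finset.univ) (f := fun _ => (0 : ℝ))
        (by simpa using hi)
      have h1 : 0 < (H ^ k) l a :=
        (pow_apply_nonneg hH k l a).lt_of_ne fun h0 => by simp [← h0] at hl
      have h2 : 0 < H i l := (hH i l).lt_of_ne fun h0 => by simp [← h0] at hl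
      rw [pow_succ', ← mulVec_mulVec, hBA, inv_mul_lt_iff₀ hr, ← hHz i]
      refine Finset.sum_lt_sum (fun j _ => mul_le_mul (hAH i j) (hz1 _ j)
        (mulVec_nonneg_of_nonneg (pow_apply_nonneg hB0 _) (fun i => (hz i).le) j) (hH i j))
        ⟨l, Finset.mem_univ l, ?_⟩
      calc A i l * ((B ^ (k + 1)) *ᵥ z) l ≤ H i l * ((B ^ (k + 1)) *ᵥ z) l :=
            mul_le_mul_of_nonneg_right (hAH i l)
              (mulVec_nonneg_of_nonneg (pow_apply_nonneg hB0 _) (fun i => (hz i).le) l)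
        _ < H i l * z l := mul_lt_mul_of_pos_left (ih l h1) h2
  choose k hk using fun i => hirr i a
  set N := (Finset.univ.sup k) + 1 with hN
  have hBN : ∀ i, ((B ^ N) *ᵥ z) i < z i := fun i =>
    (hanti i (Nat.succ_le_succ (Finset.le_sup (f := k) (Finset.mem_univ i)))).trans_lt
      (hstrict (k i) i (hk i))
  -- A truncated Neumann series: applying `B` telescopes to v + B ^ N z - z, which is below v by
  -- `hBN`.
  refine ⟨(∑ m ∈ Finset.range N, B ^ m) *ᵥ z, fun i => ?_, fun i => ?_⟩
  · rw [sum_mulVec, Finset.sum_apply]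
    refine Finset.sum_pos' (fun m _ => mulVec_nonneg_of_nonneg (pow_apply_nonneg hB0 m)
      (fun i => (hz i).le) i) ⟨0, by simp [hN], by simpa using hz i⟩
  · have h1 : B * ∑ m ∈ Finset.range N, B ^ m = ∑ m ∈ Finset.range N, B ^ m + B ^ N - 1 := by
      simp_rw [Finset.mul_sum, ← pow_succ']
      refine eq_sub_of_add_eq ?_
      rw [← Finset.sum_range_succ, Finset.sum_range_succ' _ N, pow_zero]
    have h2 := hBA ((∑ m ∈ Finset.range N, B ^ m) *ᵥ z) i
    rw [mulVec_mulVec, h1, sub_mulVec, add_mulVec, one_mulVec, Pi.sub_apply, Pi.add_apply] at h2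
    rw [eq_inv_mul_iff_mul_eq₀ hr.ne'] at h2
    rw [← h2]
    exact mul_lt_mul_of_pos_left (by linarith [hBN i]) hr

end Matrix

/-! ### The reward-weighted kernel and its Perron eigenvectors. -/

namespace ALMDP

variable {S : Type*} [Fintype S]

/-- The reward-weighted passive dynamics, whose eigenvalue equation is the Bellman equation. -/
noncomputable def kernel (L : ALMDP S) (η : ℝ) : Matrix S S ℝ :=
  fun s s' => Real.exp (η * L.R s) * L.P s s'

theorem kernel_nonneg (L : ALMDP S) (η : ℝ) (s s' : S) : 0 ≤ L.kernel η s s' :=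
  mul_nonneg (Real.exp_pos _).le (L.P_nonneg s s')

theorem kernel_pos {L : ALMDP S} (η : ℝ) {s s' : S} (h : 0 < L.P s s') : 0 < L.kernel η s s' :=
  mul_pos (Real.exp_pos _) h

theorem kernel_mulVec (L : ALMDP S) (η : ℝ) (z : S → ℝ) (s : S) :
    (L.kernel η).mulVec z s = Real.exp (η * L.R s) * ∑ s', L.P s s' * z s' := by
  simp only [Matrix.mulVec, dotProduct, kernel, Finset.mul_sum, mul_assoc]

theorem bellman_iff {η ρ : ℝ} (L : ALMDP S) (z : S → ℝ) (s : S) :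
    z s = Real.exp (η * (L.R s - ρ)) * ∑ s', L.P s s' * z s' ↔
      (L.kernel η).mulVec z s = Real.exp (η * ρ) * z s := by
  rw [kernel_mulVec, mul_sub, Real.exp_sub, div_mul_eq_mul_div, eq_div_iff (Real.exp_pos _).ne',
    mul_comm (z s), eq_comm]

theorem IsPolicy.pos_of_pos {L : ALMDP S} {π : Matrix S S ℝ} (hπ : L.IsPolicy π) {s s' : S}
    (h : 0 < π s s') : 0 < L.P s s' :=
  (L.P_nonneg s s').lt_of_ne fun h0 => h.ne' (hπ.abs_cont s s' h0.symm)

theorem IsOptimalValue.sum_pos {L : ALMDP S} {η ρ : ℝ} {sRef : S} {z : S → ℝ}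
    (hz : L.IsOptimalValue η ρ sRef z) (s : S) : 0 < ∑ s', L.P s s' * z s' := by
  have h := hz.pos s
  rw [hz.bellman s] at h
  exact pos_of_mul_pos_right h (Real.exp_pos _).le

variable [DecidableEq S]

theorem Communicating.kernel_irreducible {L : ALMDP S} (hL : L.Communicating) (η : ℝ) (s s' : S) :
    ∃ k, 0 < (L.kernel η ^ k) s s' := by
  obtain ⟨π, hπ, k, hk⟩ := hL s s'
  exact ⟨k, Matrix.pow_apply_pos_of_support hπ.nonneg (L.kernel_nonneg η)
    (fun i j h => kernel_pos η (hπ.pos_of_pos h)) k s s' hk⟩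

/-- The Perron–Frobenius theorem for the reward-weighted passive dynamics. -/
theorem Communicating.exists_eigenvectors {L : ALMDP S} (hL : L.Communicating) {η : ℝ}
    (hη : 0 < η) (sRef : S) :
    ∃ (ρ : ℝ) (z y : S → ℝ), L.IsOptimalValue η ρ sRef z ∧ (∀ s, 0 < y s) ∧
      ∀ x : S → ℝ, ∑ s, y s * (L.kernel η).mulVec x s = Real.exp (η * ρ) * ∑ s, y s * x s := by
  have : Nonempty S := ⟨sRef⟩
  obtain ⟨r, z, hz, hr⟩ := Matrix.exists_pos_eigenvector (L.kernel_nonneg η)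
    (hL.kernel_irreducible η)
  obtain ⟨r', y, hy, hr'⟩ := Matrix.exists_pos_eigenvector (A := (L.kernel η).transpose)
    (fun i j => L.kernel_nonneg η j i) (fun i j => by
      obtain ⟨k, hk⟩ := hL.kernel_irreducible η j i
      exact ⟨k, by rwa [← Matrix.transpose_pow]⟩)
  have hleft : ∀ x : S → ℝ, ∑ s, y s * (L.kernel η).mulVec x s = r' * ∑ s, y s * x s := by
    intro x
    have h1 : (fun s => ((L.kernel η).transpose.mulVec y) s) = fun s => r' * y s := funext hr'
    calc ∑ s, y s * (L.kernel η).mulVec x s = dotProduct y ((L.kernel η).mulVec x) := rfl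
      _ = dotProduct ((L.kernel η).transpose.mulVec y) x := by
        rw [Matrix.dotProduct_mulVec, Matrix.mulVec_transpose]
      _ = ∑ s, r' * y s * x s := Finset.sum_congr rfl fun s _ => by rw [hr' s]
      _ = r' * ∑ s, y s * x s := by simp only [Finset.mul_sum, mul_assoc]
  have hyz : 0 < ∑ s, y s * z s :=
    Finset.sum_pos (fun s _ => mul_pos (hy s) (hz s)) Finset.univ_nonempty
  -- Evaluating y K z in two ways identifies the left and right eigenvalues.
  have hrr : r = r' := by
    have h1 := hleft z
    simp only [hr, mul_left_comm, ← Finset.mul_sum] at h1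
    exact mul_right_cancel₀ hyz.ne' h1
  -- The row `sRef` of `P` sums to 1, so it has a positive entry.
  have hr0 : 0 < r := by
    obtain ⟨s', -, hs'⟩ := Finset.exists_lt_of_sum_lt (s := Finset.univ) (f := fun _ => (0 : ℝ))
      (g := L.P sRef) (by simp [L.P_sum])
    have h1 : 0 < (L.kernel η).mulVec z sRef :=
      Finset.sum_pos' (fun j _ => mul_nonneg (L.kernel_nonneg η _ _) (hz j).le)
        ⟨s', Finset.mem_univ _, mul_pos (kernel_pos η hs') (hz s')⟩
    rw [hr] at h1
    exact pos_of_mul_pos_left h1 (hz sRef).le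
  have hexp : Real.exp (η * (Real.log r / η)) = r := by
    rw [mul_div_cancel₀ _ hη.ne', Real.exp_log hr0]
  refine ⟨Real.log r / η, (z sRef)⁻¹ • z, y, ⟨fun s => mul_pos (inv_pos.2 (hz sRef)) (hz s),
    inv_mul_cancel₀ (hz sRef).ne', fun s => ?_⟩, hy, fun x => ?_⟩
  · rw [bellman_iff, hexp, Matrix.mulVec_smul, Pi.smul_apply, Pi.smul_apply, hr, smul_eq_mul,
      smul_eq_mul, mul_left_comm]
  · rw [hexp, hleft, hrr]

end ALMDP

/-! ### The optimal gain: Bellman inequality and telescoping. -/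

namespace ALMDP

section gain

variable {S : Type*} [Fintype S] {L : ALMDP S} {η ρ : ℝ} {sRef : S} {z : S → ℝ}

theorem IsOptimalValue.log_eq (hz : L.IsOptimalValue η ρ sRef z) (hη : 0 < η) (s : S) :
    Real.log (z s) / η + ρ = L.R s + Real.log (∑ s', L.P s s' * z s') / η := by
  have h := congrArg Real.log (hz.bellman s)
  rw [Real.log_mul (Real.exp_pos _).ne' (hz.sum_pos s).ne', Real.log_exp] at h
  rw [h]
  field_simp
  ring

/-- The Bellman inequality for an arbitrary policy. -/
theorem IsOptimalValue.sum_reward_le (hz : L.IsOptimalValue η ρ sRef z) (hη : 0 < η)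
    {π : Matrix S S ℝ} (hπ : L.IsPolicy π) (x : S) :
    ∑ y, π x y * (L.reward η π x y + Real.log (z y) / η) ≤ Real.log (z x) / η + ρ := by
  rw [hz.log_eq hη]
  set w := ∑ s', L.P x s' * z s' with hw
  have hw0 : 0 < w := hz.sum_pos x
  -- This is log t ≤ t - 1 at t = P z / (π w). The corrections on the right sum to zero over `y`.
  -- Where `π x y = 0`, the value of the logarithm is irrelevant.
  have hterm : ∀ y, π x y * (L.reward η π x y + Real.log (z y) / η) ≤
      π x y * (L.R x + Real.log w / η) + (1 / η) * (L.P x y * z y / w - π x y) := by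
    intro y
    rcases (hπ.nonneg x y).eq_or_lt with h0 | hpos
    · rw [← h0]
      have := mul_nonneg (L.P_nonneg x y) (hz.pos y).le
      simp only [zero_mul, zero_add, sub_zero]
      positivity
    · have hP := hπ.pos_of_pos hpos
      have hzy := hz.pos y
      have hlog : Real.log (L.P x y * z y / (π x y * w)) ≤ L.P x y * z y / (π x y * w) - 1 :=
        Real.log_le_sub_one_of_pos (by positivity)
      rw [Real.log_div (by positivity) (by positivity), Real.log_mul hP.ne' hzy.ne',
        Real.log_mul hpos.ne' hw0.ne'] at hlog
      have h1 := mul_le_mul_of_nonneg_left hlog (by positivity : 0 ≤ π x y * (1 / η))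
      have h2 : π x y * (1 / η) * (L.P x y * z y / (π x y * w) - 1) =
          (1 / η) * (L.P x y * z y / w - π x y) := by
        field_simp
      rw [h2] at h1
      rw [reward, Real.log_div hpos.ne' hP.ne']
      refine le_trans (le_of_eq ?_) (add_le_add_right h1 _)
      ring
  refine (Finset.sum_le_sum fun y _ => hterm y).trans (le_of_eq ?_)
  rw [Finset.sum_add_distrib, ← Finset.sum_mul, hπ.sum_eq_one, ← Finset.mul_sum,
    Finset.sum_sub_distrib, hπ.sum_eq_one, ← Finset.sum_div, ← hw, div_self hw0.ne']
  ring

/-- The policy that is greedy with respect to the value function `z`. -/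
noncomputable def greedy (L : ALMDP S) (z : S → ℝ) : Matrix S S ℝ :=
  fun s s' => L.P s s' * z s' / ∑ x, L.P s x * z x

theorem IsOptimalValue.isPolicy_greedy (hz : L.IsOptimalValue η ρ sRef z) :
    L.IsPolicy (L.greedy z) where
  nonneg s s' := div_nonneg (mul_nonneg (L.P_nonneg s s') (hz.pos s').le) (hz.sum_pos s).le
  sum_eq_one s := by
    simp only [greedy]
    rw [← Finset.sum_div, div_self (hz.sum_pos s).ne']
  abs_cont s s' h := by simp [greedy, h]

theorem IsOptimalValue.sum_reward_greedy (hz : L.IsOptimalValue η ρ sRef z) (hη : 0 < η) (x : S) :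
    ∑ y, L.greedy z x y * (L.reward η (L.greedy z) x y + Real.log (z y) / η) =
      Real.log (z x) / η + ρ := by
  rw [hz.log_eq hη]
  have hw0 := hz.sum_pos x
  have hterm : ∀ y, L.greedy z x y * (L.reward η (L.greedy z) x y + Real.log (z y) / η) =
      L.greedy z x y * (L.R x + Real.log (∑ s', L.P x s' * z s') / η) := by
    intro y
    rcases (L.P_nonneg x y).eq_or_lt with h0 | hpos
    · simp [greedy, ← h0]
    · have hzy := hz.pos y
      have h1 : L.greedy z x y / L.P x y = z y / ∑ s', L.P x s' * z s' := by
        simp only [greedy]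
        field_simp
      rw [reward, h1, Real.log_div hzy.ne' hw0.ne']
      ring
  rw [Finset.sum_congr rfl fun y _ => hterm y, ← Finset.sum_mul, hz.isPolicy_greedy.sum_eq_one,
    one_mul]

variable [DecidableEq S]

theorem IsPolicy.pow_sum_eq_one {π : Matrix S S ℝ} (hπ : L.IsPolicy π) (t : ℕ) (s : S) :
    ∑ x, (π ^ t) s x = 1 := by
  induction t generalizing s with
  | zero => simp [Matrix.one_apply]
  | succ t ih =>
    simp only [pow_succ, Matrix.mul_apply]
    rw [Finset.sum_comm]
    simp only [← Finset.mul_sum, hπ.sum_eq_one, mul_one, ih]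

theorem IsPolicy.abs_mulVec_le {π : Matrix S S ℝ} (hπ : L.IsPolicy π) (v : S → ℝ) (t : ℕ) (s : S) :
    |((π ^ t).mulVec v) s| ≤ ∑ x, |v x| := by
  refine (Finset.abs_sum_le_sum_abs _ _).trans (Finset.sum_le_sum fun x _ => ?_)
  have h0 := Matrix.pow_apply_nonneg hπ.nonneg t s
  have h1 : (π ^ t) s x ≤ 1 := by
    rw [← hπ.pow_sum_eq_one t s]
    exact Finset.single_le_sum (fun x _ => h0 x) (Finset.mem_univ x)
  rw [abs_mul, abs_of_nonneg (h0 x)]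
  exact mul_le_of_le_one_left (abs_nonneg _) h1

/-- Adding the expected value after the step brings the one-step Bellman relation under `π ^ t`;
summing over `t` then telescopes. -/
theorem expectedReward_add (π : Matrix S S ℝ) (v : S → ℝ) (s : S) (t : ℕ) :
    L.expectedReward η π s t + ((π ^ (t + 1)).mulVec v) s =
      ((π ^ t).mulVec fun x => ∑ y, π x y * (L.reward η π x y + v y)) s := by
  rw [pow_succ, ← Matrix.mulVec_mulVec]
  simp only [expectedReward, Matrix.mulVec, dotProduct]
  rw [← Finset.sum_add_distrib]
  refine Finset.sum_congr rfl fun x _ => ?_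
  simp only [mul_add, Finset.sum_add_distrib, Finset.mul_sum, mul_assoc]

theorem IsPolicy.mulVec_add_const {π : Matrix S S ℝ} (hπ : L.IsPolicy π) (v : S → ℝ) (c : ℝ)
    (t : ℕ) (s : S) :
    ((π ^ t).mulVec fun x => v x + c) s = ((π ^ t).mulVec v) s + c := by
  simp only [Matrix.mulVec, dotProduct, mul_add, Finset.sum_add_distrib, ← Finset.sum_mul,
    hπ.pow_sum_eq_one, one_mul]

/-- `HasGain` divides a sum of `T + 1` rewards by `T`. The surplus `ρ` and the boundary terms of the
telescoped sum stay bounded, so they vanish in the average. -/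
theorem tendsto_average_of_bounded {V : ℕ → ℝ} {C : ℝ} (hV : ∀ t, |V t| ≤ C) (ρ : ℝ) :
    Tendsto (fun T : ℕ => (1 / (T : ℝ)) * (((T : ℝ) + 1) * ρ + V 0 - V (T + 1))) atTop (𝓝 ρ) := by
  have h1 : Tendsto (fun T : ℕ => (1 / (T : ℝ)) * (ρ + V 0 - V (T + 1))) atTop (𝓝 0) := by
    refine (tendsto_one_div_atTop_nhds_zero_nat (𝕜 := ℝ)).zero_mul_isBoundedUnder_le
      (isBoundedUnder_of ⟨|ρ| + C + C, fun T => ?_⟩)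
    simp only [Function.comp, Real.norm_eq_abs]
    have h2 := abs_sub (ρ + V 0) (V (T + 1))
    have h3 := abs_add_le ρ (V 0)
    linarith [hV 0, hV (T + 1)]
  have h2 : Tendsto (fun T : ℕ => ρ + (1 / (T : ℝ)) * (ρ + V 0 - V (T + 1))) atTop (𝓝 ρ) := by
    simpa using h1.const_add ρ
  refine h2.congr' ?_
  filter_upwards [eventually_gt_atTop 0] with T hT
  have : (T : ℝ) ≠ 0 := by positivity
  field_simp
  ring

/-- The eigenvalue of the exponentiated Bellman operator is the optimal gain. -/
theorem IsOptimalValue.isOptimalGain (hz : L.IsOptimalValue η ρ sRef z) (hη : 0 < η) :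
    L.IsOptimalGain η ρ := by
  intro s
  set v : S → ℝ := fun x => Real.log (z x) / η with hv
  constructor
  · have hπ := hz.isPolicy_greedy
    refine ⟨L.greedy z, hπ, ?_⟩
    have hE : ∀ t, L.expectedReward η (L.greedy z) s t =
        ρ + (((L.greedy z) ^ t).mulVec v) s - (((L.greedy z) ^ (t + 1)).mulVec v) s := by
      intro t
      have h1 := expectedReward_add (L := L) (η := η) (L.greedy z) v s t
      simp only [hv, hz.sum_reward_greedy hη] at h1
      rw [hπ.mulVec_add_const] at h1
      linarith
    refine (tendsto_average_of_bounded (fun t => hπ.abs_mulVec_le v t s) ρ).congr fun T => ?_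
    congr 1
    have hsum : ∀ n : ℕ, ∑ t ∈ Finset.range n, L.expectedReward η (L.greedy z) s t =
        n * ρ + (((L.greedy z) ^ 0).mulVec v) s - (((L.greedy z) ^ n).mulVec v) s := by
      intro n
      induction n with
      | zero => simp
      | succ n ih =>
        rw [Finset.sum_range_succ, ih, hE]
        push_cast
        ring
    rw [hsum]
    push_cast
    ring
  · rintro g ⟨π, hπ, hg⟩
    have hE : ∀ t, L.expectedReward η π s t ≤
        ρ + ((π ^ t).mulVec v) s - ((π ^ (t + 1)).mulVec v) s := by
      intro t
      have h1 := expectedReward_add (L := L) (η := η) π v s t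
      have h2 := Matrix.mulVec_mono_of_nonneg (Matrix.pow_apply_nonneg hπ.nonneg t)
        (fun x => hz.sum_reward_le hη hπ x) s
      rw [hπ.mulVec_add_const] at h2
      simp only [hv] at h1 h2 ⊢
      linarith
    have hsum : ∀ n : ℕ, ∑ t ∈ Finset.range n, L.expectedReward η π s t ≤
        n * ρ + ((π ^ 0).mulVec v) s - ((π ^ n).mulVec v) s := by
      intro n
      induction n with
      | zero => simp
      | succ n ih =>
        rw [Finset.sum_range_succ]
        have := hE n
        push_cast
        linarith
    refine le_of_tendsto_of_tendsto' hg
      (tendsto_average_of_bounded (fun t => hπ.abs_mulVec_le v t s) ρ) fun T => ?_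
    refine mul_le_mul_of_nonneg_left ?_ (by positivity)
    have := hsum (T + 1)
    push_cast at this
    exact this

end gain

end ALMDP

/-! ### The binary search. -/

namespace ALMDP

namespace Decomposition

section bisection

variable {S ι : Type*} [Fintype S] {L : ALMDP S} (D : Decomposition L ι)

/-- The invariant of the binary search for `Γ` that starts with an interval of the length `h`. -/
structure Brackets (η : ℝ) (sRef : S) (Γ h : ℝ) (σ : D.State) : Prop where
  lo_nonneg : 0 ≤ σ.lo
  lo_le : σ.lo ≤ Γ
  le_hi : Γ ≤ σ.hi
  est : σ.hi - σ.lo = h ∨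
    ∃ g, σ.lo ≤ g ∧ g ≤ σ.hi ∧ (D.Solvable η sRef g → σ.est = some (D.solve η sRef g))

variable {D} {η : ℝ} {sRef : S} {Γ h : ℝ}

theorem step_width (σ : D.State) :
    (D.step η sRef σ).hi - (D.step η sRef σ).lo = (σ.hi - σ.lo) / 2 := by
  simp only [step]
  split_ifs <;> simp only <;> ring

theorem Brackets.step (hΓ : 0 < Γ) (hgt : ∀ g, Γ ≤ g → D.Solvable η sRef g)
    (htest : ∀ g, 0 < g → D.Solvable η sRef g → (TooLarge η sRef (D.solve η sRef g) ↔ Γ < g))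
    {σ : D.State} (hσ : D.Brackets η sRef Γ h σ) :
    D.Brackets η sRef Γ h (D.step η sRef σ) := by
  obtain ⟨h0, h1, h2, -⟩ := hσ
  have hpos : 0 < (σ.hi + σ.lo) / 2 := by linarith
  simp only [Decomposition.step]
  split_ifs with hs ht
  · rw [htest _ hpos hs] at ht
    exact ⟨h0, h1, ht.le, Or.inr ⟨_, by simp only; linarith, le_rfl, fun _ => rfl⟩⟩
  · rw [htest _ hpos hs, not_lt] at ht
    exact ⟨hpos.le, ht, h2, Or.inr ⟨_, le_rfl, by simp only; linarith, fun _ => rfl⟩⟩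
  -- Every estimate from Γ on is solvable, so a failure means that the estimate is too small.
  · have ht : (σ.hi + σ.lo) / 2 ≤ Γ := le_of_not_ge fun hle => hs (hgt _ hle)
    exact ⟨hpos.le, ht, h2, Or.inr ⟨_, le_rfl, by simp only; linarith, fun h => (hs h).elim⟩⟩

theorem loop_iff_of_le {ε : ℝ} {σ τ : D.State} (hσ : σ.hi - σ.lo ≤ ε) :
    D.Loop η sRef ε σ τ ↔ τ = σ := by
  constructor
  · rintro (⟨_, _⟩ | ⟨_, _, hlt, _⟩)
    · rfl
    · exact absurd hσ (not_le.2 hlt)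
  · rintro rfl
    exact Loop.halt _ (not_lt.2 hσ)

theorem loop_iff_of_lt {ε : ℝ} {σ τ : D.State} (hσ : ε < σ.hi - σ.lo) :
    D.Loop η sRef ε σ τ ↔ D.Loop η sRef ε (D.step η sRef σ) τ := by
  constructor
  · rintro (⟨_, hle⟩ | ⟨_, _, _, hl⟩)
    · exact absurd hσ hle
    · exact hl
  · exact Loop.next _ _ hσ

/-- The loop halts, in a unique state, and preserves every invariant of its body. -/
theorem exists_loop_iff {ε : ℝ} {I : D.State → Prop}
    (hI : ∀ σ, I σ → I (D.step η sRef σ)) (n : ℕ) :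
    ∀ σ : D.State, I σ → σ.hi - σ.lo ≤ 2 ^ n * ε →
      ∃ σ', (∀ τ, D.Loop η sRef ε σ τ ↔ τ = σ') ∧ I σ' ∧ σ'.hi - σ'.lo ≤ ε := by
  induction n with
  | zero =>
    intro σ hσ hw
    rw [pow_zero, one_mul] at hw
    exact ⟨σ, fun τ => loop_iff_of_le hw, hσ, hw⟩
  | succ n ih =>
    intro σ hσ hw
    rcases le_or_gt (σ.hi - σ.lo) ε with hle | hlt
    · exact ⟨σ, fun τ => loop_iff_of_le hle, hσ, hle⟩
    · simp_rw [loop_iff_of_lt hlt]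
      refine ih _ (hI σ hσ) ?_
      rw [step_width]
      rw [pow_succ] at hw
      linarith

theorem exists_haltsIn_iff (hΓ : 0 < Γ) (hgt : ∀ g, Γ ≤ g → D.Solvable η sRef g)
    (htest : ∀ g, 0 < g → D.Solvable η sRef g → (TooLarge η sRef (D.solve η sRef g) ↔ Γ < g))
    (hh : Γ ≤ h) {ε : ℝ} (hε : 0 < ε) :
    ∃ σ : D.State, (∀ σ', D.HaltsIn η sRef h ε σ' ↔ σ' = σ) ∧ D.Brackets η sRef Γ h σ ∧
      σ.hi - σ.lo ≤ ε := by
  obtain ⟨n, hn⟩ := pow_unbounded_of_one_lt (h / ε) (one_lt_two (α := ℝ))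
  refine exists_loop_iff (fun σ hσ => hσ.step hΓ hgt htest) n ⟨0, h, none⟩
    ⟨le_rfl, hΓ.le, hh, Or.inl (sub_zero h)⟩ ?_
  rw [div_lt_iff₀ hε] at hn
  simpa using hn.le

/-- The output of the binary search: for small `ε`, the solutions for an estimate within `ε`. -/
theorem exists_returns (hΓ : 0 < Γ) (hgt : ∀ g, Γ ≤ g → D.Solvable η sRef g)
    (htest : ∀ g, 0 < g → D.Solvable η sRef g → (TooLarge η sRef (D.solve η sRef g) ↔ Γ < g))
    (hnear : ∀ᶠ g in 𝓝 Γ, D.Solvable η sRef g) (hh : Γ ≤ h) :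
    ∃ g : ℝ → ℝ, (∀ᶠ ε in 𝓝[>] (0 : ℝ), D.Returns η sRef h ε (D.solve η sRef (g ε))) ∧
      Tendsto g (𝓝[>] 0) (𝓝 Γ) := by
  have key : ∀ ε : ℝ, ∃ g : ℝ, 0 < ε → ε < h → |g - Γ| ≤ ε ∧
      (D.Solvable η sRef g → D.Returns η sRef h ε (D.solve η sRef g)) := by
    intro ε
    by_cases hε : 0 < ε
    · obtain ⟨σ, hσ, hb, hw⟩ := exists_haltsIn_iff hΓ hgt htest hh hε
      rcases hb.est with heq | ⟨g, hg1, hg2, hg⟩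
      -- A final width of `h` means that the loop body never ran, which `ε < h` excludes.
      · exact ⟨0, fun _ hlt => absurd hlt (not_lt.2 (heq ▸ hw))⟩
      · refine ⟨g, fun _ _ => ⟨abs_le.2 ⟨?_, ?_⟩, fun hs => ⟨σ, (hσ σ).2 rfl, hg hs⟩⟩⟩
        · linarith [hb.le_hi]
        · linarith [hb.lo_le]
    · exact ⟨0, fun h => absurd h hε⟩
  choose g hg using key
  have hsmall : ∀ᶠ ε in 𝓝[>] (0 : ℝ), 0 < ε ∧ ε < h := by
    filter_upwards [Ioo_mem_nhdsGT (hΓ.trans_le hh)] with ε hε using hε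
  have hlim : Tendsto g (𝓝[>] 0) (𝓝 Γ) := by
    rw [tendsto_iff_norm_sub_tendsto_zero]
    refine squeeze_zero' (Eventually.of_forall fun _ => norm_nonneg _)
      (hsmall.mono fun ε hε => (hg ε hε.1 hε.2).1) ?_
    exact tendsto_id.mono_left nhdsWithin_le_nhds
  refine ⟨g, ?_, hlim⟩
  filter_upwards [hsmall, hlim.eventually hnear] with ε hε hs
  exact (hg ε hε.1 hε.2).2 hs

end bisection

end Decomposition

end ALMDP

/-! ### Subtask equivalences and superposition of base solutions. -/

namespace ALMDP

section blocks

variable {S ι : Type*} [Fintype S] {L : ALMDP S}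

theorem IsSubtaskEquiv.bijOn_union {part : S → ι} {i j : ι} {f : S → S}
    (hf : L.IsSubtaskEquiv part i j f) :
    Set.BijOn f (block part i ∪ L.terminals part i) (block part j ∪ L.terminals part j) := by
  refine hf.block_bij.union hf.terminals_bij ?_
  have hne : ∀ a ∈ block part i, ∀ b ∈ L.terminals part i, f a ≠ f b := fun a ha b hb hab =>
    (hf.terminals_bij.mapsTo hb).1 (hab ▸ hf.block_bij.mapsTo ha)
  rintro a (ha | ha) b (hb | hb) hab
  · exact hf.block_bij.injOn ha hb hab
  · exact (hne a ha b hb hab).elim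
  · exact (hne b hb a ha hab.symm).elim
  · exact hf.terminals_bij.injOn ha hb hab

theorem P_eq_zero_of_notMem {part : S → ι} {s s' : S}
    (h : s' ∉ block part (part s) ∪ L.terminals part (part s)) : L.P s s' = 0 := by
  by_contra hne
  exact h (Or.inr ⟨fun hb => h (Or.inl hb), s, rfl, (L.P_nonneg s s').lt_of_ne' hne⟩)

/-- No transition leaves a block together with its terminals, so both sums reduce to the sets on
which `f` is a bijection; elsewhere `f` is arbitrary. -/
theorem IsSubtaskEquiv.sum_eq {part : S → ι} {i j : ι} {f : S → S}
    (hf : L.IsSubtaskEquiv part i j f) {s : S} (hs : s ∈ block part i) (z : S → ℝ) :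
    ∑ t, L.P (f s) t * z t = ∑ t, L.P s t * z (f t) := by
  classical
  have hfs : part (f s) = j := hf.block_bij.mapsTo hs
  have hs' : part s = i := hs
  rw [← Finset.sum_subset (Finset.subset_univ
      (Finset.univ.filter (· ∈ block part j ∪ L.terminals part j))) fun t _ ht => ?_,
    ← Finset.sum_subset (Finset.subset_univ
      (Finset.univ.filter (· ∈ block part i ∪ L.terminals part i))) fun t _ ht => ?_]
  · symm
    refine Finset.sum_nbij f (fun t ht => ?_) ?_ ?_ fun t ht => ?_
    · simpa using hf.bijOn_union.mapsTo (by simpa using ht)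
    · simpa only [Finset.coe_filter, Finset.mem_univ, true_and, Set.ofPred_mem_eq] using
        hf.bijOn_union.injOn
    · simpa only [Finset.coe_filter, Finset.mem_univ, true_and, Set.ofPred_mem_eq] using
        hf.bijOn_union.surjOn
    · rw [hf.prob_eq s hs t (by simpa using ht)]
  · rw [P_eq_zero_of_notMem (part := part) (by rw [hs']; simpa using ht), zero_mul]
  · rw [P_eq_zero_of_notMem (part := part) (by rw [hfs]; simpa using ht), zero_mul]

end blocks

namespace Decomposition

variable {S ι : Type*} [Fintype S] {L : ALMDP S} (D : Decomposition L ι)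

open scoped Classical in
/-- The extension by zero of a function on the exit states. -/
noncomputable def extend (w : D.exits → ℝ) (s : S) : ℝ :=
  if h : s ∈ D.exits then w ⟨s, h⟩ else 0

/-- The value function of the base LMDP of the subtask `i` and its terminal state `τ`, transported
from the class representative. -/
noncomputable def transported (base : ι → S → S → ℝ) (i : ι) (τ s : S) : ℝ :=
  base (D.rep i) (D.toRep i τ) (D.toRep i s)

variable {D} {η Γ : ℝ} {sRef : S}

theorem extend_of_mem (w : D.exits → ℝ) {s : S} (h : s ∈ D.exits) : D.extend w s = w ⟨s, h⟩ :=
  dif_pos h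

theorem mem_T_of_P_ne_zero {s s' : S} (h : L.P s s' ≠ 0) (hs : D.part s' ≠ D.part s) :
    s' ∈ D.T (D.part s) :=
  ⟨hs, s, rfl, (L.P_nonneg s s').lt_of_ne' h⟩

open scoped Classical in
theorem compose_eq (e : D.Estimate) (s : S) :
    e.compose s = ∑ τ, if τ ∈ D.T (D.part s) then
      D.extend e.zE τ * D.transported e.base (D.part s) τ s else 0 := by
  rw [← Finset.sum_filter, Estimate.compose]
  rw [Finset.sum_subtype (Finset.univ.filter (· ∈ D.T (D.part s))) (p := (· ∈ D.T (D.part s)))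
    (by simp)]
  refine Finset.sum_congr rfl fun τ _ => ?_
  rw [extend_of_mem _ (D.mem_exits τ.2), transported]

open scoped Classical in
-- Hence the exit system says that, away from `sRef`, the exit values reproduce themselves under
-- composition.
theorem G_mulVec_eq (w : D.exits → ℝ) (s : D.exits) :
    (D.G η Γ).mulVec w s = (Estimate.mk Γ (D.baseSolution η Γ) w : D.Estimate).compose s.1 := by
  rw [compose_eq]
  simp only [Matrix.mulVec, dotProduct, G]
  rw [← Finset.sum_subset (Finset.subset_univ (Finset.univ.filter (· ∈ D.exits))) fun t _ ht => ?_,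
    Finset.sum_subtype (Finset.univ.filter (· ∈ D.exits)) (p := (· ∈ D.exits)) (by simp)]
  · refine Finset.sum_congr rfl fun τ _ => ?_
    rw [ite_mul, zero_mul, extend_of_mem w τ.2, transported, mul_comm]
  · exact if_neg fun h => ht (by simpa using D.mem_exits h)

/-- The values `base` solve the base LMDPs of all class representatives. -/
def SolvesBase (D : Decomposition L ι) (η Γ : ℝ) (base : ι → S → S → ℝ) : Prop :=
  ∀ j ∈ Set.range D.rep, ∀ τ ∈ D.T j, D.IsBaseSolution η Γ j τ (base j τ)

theorem solvesBase_baseSolution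
    (h : ∀ j ∈ Set.range D.rep, ∀ τ ∈ D.T j, ∃ z, D.IsBaseSolution η Γ j τ z) :
    D.SolvesBase η Γ (D.baseSolution η Γ) :=
  fun j hj τ hτ => Classical.epsilon_spec (h j hj τ hτ)

theorem exp_reward_sub (hη : 0 < η) (hΓ : 0 < Γ) (r : ℝ) :
    Real.exp (η * (r - Real.log Γ / η)) = Real.exp (η * r) / Γ := by
  rw [mul_sub, mul_div_cancel₀ _ hη.ne', Real.exp_sub, Real.exp_log hΓ]

open scoped Classical in
-- The base equation of the representative, pulled back along the equivalence. Injectivity on the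
-- terminals ensures that only `τ` carries the value 1.
theorem SolvesBase.transported_eq {base : ι → S → S → ℝ} (h : D.SolvesBase η Γ base) (hη : 0 < η)
    (hΓ : 0 < Γ) {s τ : S} (hτ : τ ∈ D.T (D.part s)) :
    Γ * D.transported base (D.part s) τ s = ∑ s', L.kernel η s s' *
      if D.part s' = D.part s then D.transported base (D.part s) τ s'
      else if s' = τ then 1 else 0 := by
  have he := D.equiv (D.part s)
  have hs : s ∈ block D.part (D.part s) := rfl
  have hsol := h _ ⟨_, rfl⟩ _ (he.terminals_bij.mapsTo hτ)
  have hb := hsol.bellman _ (he.block_bij.mapsTo hs)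
  simp only [exp_reward_sub hη hΓ] at hb
  rw [transported, hb, div_mul_eq_mul_div, mul_div_cancel₀ _ hΓ.ne', he.sum_eq hs,
    he.reward_eq s hs, Finset.mul_sum]
  refine Finset.sum_congr rfl fun t _ => ?_
  rw [kernel, mul_assoc]
  congr 1
  by_cases hP : L.P s t = 0
  · rw [hP, zero_mul, zero_mul]
  congr 1
  split_ifs with h1 h2
  · rfl
  · subst h2
    rw [hsol.terminal _ (he.terminals_bij.mapsTo hτ).1, if_pos rfl]
  · have ht := mem_T_of_P_ne_zero hP h1
    rw [hsol.terminal _ (he.terminals_bij.mapsTo ht).1,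
      if_neg fun heq => h2 (he.terminals_bij.injOn ht hτ heq)]

open scoped Classical in
/-- The composed values satisfy the Bellman equation inside the blocks, with the exit values as
the boundary values. -/
theorem compose_bellman {e : D.Estimate} (h : D.SolvesBase η Γ e.base) (hη : 0 < η) (hΓ : 0 < Γ)
    (s : S) :
    Γ * e.compose s = ∑ s', L.kernel η s s' *
      if D.part s' = D.part s then e.compose s' else D.extend e.zE s' := by
  have h1 : ∀ τ, Γ * (if τ ∈ D.T (D.part s) then
      D.extend e.zE τ * D.transported e.base (D.part s) τ s else 0) =
      ∑ s', L.kernel η s s' * if τ ∈ D.T (D.part s) then D.extend e.zE τ *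
        (if D.part s' = D.part s then D.transported e.base (D.part s) τ s'
          else if s' = τ then 1 else 0) else 0 := by
    intro τ
    split_ifs with hτ
    · rw [mul_left_comm, h.transported_eq hη hΓ hτ, Finset.mul_sum]
      exact Finset.sum_congr rfl fun s' _ => mul_left_comm _ _ _
    · simp
  rw [compose_eq, Finset.mul_sum, Finset.sum_congr rfl fun τ _ => h1 τ, Finset.sum_comm]
  -- By linearity each successor is treated alone: inside the block the sum over `τ` is a composed
  -- value, and at a terminal `s'` only `τ = s'` survives.
  refine Finset.sum_congr rfl fun s' _ => ?_
  rw [← Finset.mul_sum]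
  by_cases hk : L.P s s' = 0
  · simp [kernel, hk]
  congr 1
  split_ifs with hs
  · rw [compose_eq, hs]
  · have ht := mem_T_of_P_ne_zero hk hs
    rw [Finset.sum_eq_single s' (fun τ _ hτ => by simp [hτ.symm]) (by simp)]
    simp [ht]

theorem compose_nonneg {e : D.Estimate} (h : D.SolvesBase η Γ e.base) (hw : ∀ s, 0 ≤ e.zE s)
    (s : S) : 0 ≤ e.compose s :=
  Finset.sum_nonneg fun τ _ => mul_nonneg (hw _)
    ((h _ ⟨_, rfl⟩ _ ((D.equiv (D.part s)).terminals_bij.mapsTo τ.2)).nonneg _)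

end Decomposition

end ALMDP

/-! ### The cut problem, solvability, and correctness of the test. -/

namespace ALMDP

namespace Decomposition

variable {S ι : Type*} [Fintype S] {L : ALMDP S} (D : Decomposition L ι)

open scoped Classical in
/-- The reward-weighted dynamics without the transitions into `sRef` from other blocks. -/
noncomputable def cutKernel (η : ℝ) (sRef : S) : Matrix S S ℝ :=
  fun s s' => if s' = sRef ∧ D.part s ≠ D.part sRef then 0 else L.kernel η s s'

open scoped Classical in
/-- The transitions into `sRef` from other blocks. -/
noncomputable def inflow (η : ℝ) (sRef s : S) : ℝ :=
  if D.part s ≠ D.part sRef then L.kernel η s sRef else 0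

open scoped Classical in
/-- The reward-weighted dynamics restricted to the blocks. -/
noncomputable def blockKernel (η : ℝ) : Matrix S S ℝ :=
  fun s s' => if D.part s' = D.part s then L.kernel η s s' else 0

/-- The Bellman equation for `u` in which `sRef` is terminal with the value `1` if it is entered
from another block. -/
def CutBellman (η Γ : ℝ) (sRef : S) (u : S → ℝ) : Prop :=
  ∀ s, Γ * u s = (D.cutKernel η sRef).mulVec u s + D.inflow η sRef s

/-- The matrix of the cut problem has a strict positive supersolution for the eigenvalue `Γ`. -/
def Subcritical (η Γ : ℝ) (sRef : S) : Prop :=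
  ∃ v : S → ℝ, (∀ s, 0 < v s) ∧ ∀ s, (D.cutKernel η sRef).mulVec v s < Γ * v s

variable {D} {η Γ : ℝ} {sRef : S}

theorem cutKernel_nonneg (s s' : S) : 0 ≤ D.cutKernel η sRef s s' := by
  unfold cutKernel
  split_ifs
  exacts [le_rfl, L.kernel_nonneg η s s']

theorem cutKernel_le (s s' : S) : D.cutKernel η sRef s s' ≤ L.kernel η s s' := by
  unfold cutKernel
  split_ifs
  exacts [L.kernel_nonneg η s s', le_rfl]

theorem blockKernel_nonneg (s s' : S) : 0 ≤ D.blockKernel η s s' := by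
  unfold blockKernel
  split_ifs
  exacts [L.kernel_nonneg η s s', le_rfl]

theorem blockKernel_le (s s' : S) : D.blockKernel η s s' ≤ D.cutKernel η sRef s s' := by
  unfold blockKernel
  split_ifs with h
  · refine le_of_eq (if_neg ?_).symm
    rintro ⟨rfl, h'⟩
    exact h' h.symm
  · exact cutKernel_nonneg s s'

theorem inflow_nonneg (s : S) : 0 ≤ D.inflow η sRef s := by
  unfold inflow
  split_ifs
  exacts [L.kernel_nonneg η s sRef, le_rfl]

theorem inflow_self : D.inflow η sRef sRef = 0 := if_neg fun h => h rfl

/-- The cut changes only the column of `sRef`. So a cut solution with the value 1 at `sRef` is an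
eigenvector of the full kernel. -/
theorem kernel_mulVec_eq (x : S → ℝ) (s : S) :
    (L.kernel η).mulVec x s = (D.cutKernel η sRef).mulVec x s + D.inflow η sRef s * x sRef := by
  classical
  have h : ∀ s', L.kernel η s s' * x s' = D.cutKernel η sRef s s' * x s' +
      if s' = sRef then D.inflow η sRef s * x sRef else 0 := by
    intro s'
    unfold cutKernel inflow
    by_cases h1 : s' = sRef
    · subst h1
      by_cases h2 : D.part s = D.part s' <;> simp [h2]
    · simp [h1]
  simp only [Matrix.mulVec, dotProduct]
  rw [Finset.sum_congr rfl fun s' _ => h s', Finset.sum_add_distrib]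
  simp

/-- Membership of the reference state in the exits: it is entered from some other block. -/
theorem exists_pos_of_mem_exits (hRef : sRef ∈ D.exits) :
    ∃ s, D.part s ≠ D.part sRef ∧ 0 < L.kernel η s sRef := by
  obtain ⟨i, hi, s, hs, hP⟩ := Set.mem_iUnion.1 hRef
  refine ⟨s, fun h => hi ?_, kernel_pos η hP⟩
  rw [block, Set.mem_ofPred_eq, ← h]
  exact hs

theorem IsExitSolution.compose_eq {w : D.exits → ℝ} (hw : D.IsExitSolution η sRef Γ w)
    {s : S} (hs : s ∈ D.exits) (hne : s ≠ sRef) :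
    (Estimate.mk Γ (D.baseSolution η Γ) w : D.Estimate).compose s = w ⟨s, hs⟩ := by
  rw [hw.eq ⟨s, hs⟩ hne, G_mulVec_eq]

open scoped Classical in
/-- The equivalence of the cut problem and of the block problems with the boundary values `b`. -/
theorem sum_kernel_ite {u b : S → ℝ} (hb : b sRef = 1)
    (hu : ∀ s ∈ D.exits, s ≠ sRef → b s = u s) (s : S) :
    ∑ s', L.kernel η s s' * (if D.part s' = D.part s then u s' else b s') =
      (D.cutKernel η sRef).mulVec u s + D.inflow η sRef s := by
  have h : ∀ s', L.kernel η s s' * (if D.part s' = D.part s then u s' else b s') =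
      D.cutKernel η sRef s s' * u s' + if s' = sRef then D.inflow η sRef s else 0 := by
    intro s'
    unfold cutKernel inflow
    by_cases h1 : s' = sRef
    · subst h1
      by_cases h2 : D.part s = D.part s'
      · simp [h2]
      · simp [h2, Ne.symm h2, hb]
    · simp only [h1, false_and, if_false, add_zero]
      by_cases h2 : L.P s s' = 0
      · simp [kernel, h2]
      split_ifs with h3
      · rfl
      · rw [hu s' (D.mem_exits (mem_T_of_P_ne_zero h2 h3)) h1]
  rw [Finset.sum_congr rfl fun s' _ => h s', Finset.sum_add_distrib]
  simp [Matrix.mulVec, dotProduct]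

/-- Seen from other blocks, the boundary value is 1 at `sRef` and the composed value at every other
exit. Subcriticality is not needed, so this applies at estimates below Γ as well. -/
theorem IsExitSolution.cutBellman {w : D.exits → ℝ} (hw : D.IsExitSolution η sRef Γ w)
    (hbase : D.SolvesBase η Γ (D.baseSolution η Γ)) (hη : 0 < η) (hΓ : 0 < Γ)
    (hRef : sRef ∈ D.exits) :
    D.CutBellman η Γ sRef (Estimate.mk Γ (D.baseSolution η Γ) w : D.Estimate).compose := by
  intro s
  rw [compose_bellman (e := ⟨Γ, D.baseSolution η Γ, w⟩) hbase hη hΓ, sum_kernel_ite]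
  · exact (extend_of_mem w hRef).trans (hw.ref ⟨sRef, hRef⟩ rfl)
  · intro t ht hne
    rw [extend_of_mem _ ht, hw.compose_eq ht hne]

theorem Subcritical.cutBellman_unique (h : D.Subcritical η Γ sRef) {u u' : S → ℝ}
    (hu : D.CutBellman η Γ sRef u) (hu' : D.CutBellman η Γ sRef u') : u = u' := by
  classical
  obtain ⟨v, hv, hlt⟩ := h
  have hdet := Matrix.isUnit_det_of_supersolution cutKernel_nonneg hv hlt
  rw [(Matrix.resolvent_eq_iff hdet _ _).1 hu, (Matrix.resolvent_eq_iff hdet _ _).1 hu']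

theorem Subcritical.cutBellman_nonneg (h : D.Subcritical η Γ sRef) {u : S → ℝ}
    (hu : D.CutBellman η Γ sRef u) (s : S) : 0 ≤ u s := by
  obtain ⟨v, hv, hlt⟩ := h
  refine Matrix.nonneg_of_supersolution cutKernel_nonneg hv hlt (fun s => ?_) s
  rw [hu s]
  exact le_add_of_nonneg_right (inflow_nonneg s)

theorem Subcritical.blockKernel (h : D.Subcritical η Γ sRef) :
    ∃ v : S → ℝ, (∀ s, 0 < v s) ∧ ∀ s, (D.blockKernel η).mulVec v s < Γ * v s := by
  obtain ⟨v, hv, hlt⟩ := h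
  refine ⟨v, hv, fun s => lt_of_le_of_lt (Finset.sum_le_sum fun s' _ => ?_) (hlt s)⟩
  exact mul_le_mul_of_nonneg_right (blockKernel_le s s') (hv s').le

theorem Subcritical.existsUnique_base (h : D.Subcritical η Γ sRef) (hη : 0 < η) (hΓ : 0 < Γ)
    (j : ι) (τ : S) : ∃! z, D.IsBaseSolution η Γ j τ z := by
  classical
  obtain ⟨v, hv, hlt⟩ := h.blockKernel
  -- The rows outside the block are zeroed, so that there the terminal condition reads Γ z = Γ t and
  -- the base LMDP becomes one square system. Nonnegativity then comes from the maximum principle.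
  set A : Matrix S S ℝ := fun s s' => if D.part s = j then D.blockKernel η s s' else 0 with hA
  have hA0 : ∀ s s', 0 ≤ A s s' := fun s s' => by
    simp only [hA]
    split_ifs
    exacts [blockKernel_nonneg s s', le_rfl]
  have hAv : ∀ s, A.mulVec v s < Γ * v s := fun s => by
    by_cases hs : D.part s = j
    · simpa [hA, hs, Matrix.mulVec, dotProduct] using hlt s
    · simpa [hA, hs, Matrix.mulVec, dotProduct] using mul_pos hΓ (hv s)
  have hdet := Matrix.isUnit_det_of_supersolution hA0 hv hAv
  set t : S → ℝ := fun s => if s = τ then 1 else 0 with ht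
  have ht0 : ∀ s, 0 ≤ t s := fun s => by
    simp only [ht]
    split_ifs <;> norm_num
  set b : S → ℝ := fun s => if D.part s = j then
    ∑ s', L.kernel η s s' * (if D.part s' = j then 0 else t s') else Γ * t s with hb
  have hb0 : ∀ s, 0 ≤ b s := fun s => by
    simp only [hb]
    split_ifs
    · refine Finset.sum_nonneg fun s' _ => mul_nonneg (L.kernel_nonneg η s s') ?_
      split_ifs
      exacts [le_rfl, ht0 s']
    · exact mul_nonneg hΓ.le (ht0 s)
  have hin : ∀ z : S → ℝ, (∀ s, D.part s ≠ j → z s = t s) → ∀ s, D.part s = j →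
      A.mulVec z s + b s = Real.exp (η * L.R s) * ∑ s', L.P s s' * z s' := by
    intro z hz s hs
    rw [← kernel_mulVec]
    simp only [Matrix.mulVec, dotProduct, hA, hb, hs, if_true, Decomposition.blockKernel]
    rw [← Finset.sum_add_distrib]
    refine Finset.sum_congr rfl fun s' _ => ?_
    by_cases hs' : D.part s' = j
    · simp [hs']
    · simp [hs', hz s' hs']
  have hout : ∀ (z : S → ℝ) s, D.part s ≠ j → A.mulVec z s + b s = Γ * t s := by
    intro z s hs
    simp [hA, hb, hs, Matrix.mulVec, dotProduct]
  have hiff : ∀ z, D.IsBaseSolution η Γ j τ z ↔ ∀ s, Γ * z s = A.mulVec z s + b s := by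
    intro z
    constructor
    · intro hz s
      by_cases hs : D.part s = j
      · rw [hin z (fun s hs => hz.terminal s hs) s hs, hz.bellman s hs]
        simp only [exp_reward_sub hη hΓ]
        rw [div_mul_eq_mul_div, mul_div_cancel₀ _ hΓ.ne']
      · rw [hout z s hs, hz.terminal s hs]
    · intro hz
      have hterm : ∀ s, D.part s ≠ j → z s = t s := fun s hs =>
        mul_left_cancel₀ hΓ.ne' ((hz s).trans (hout z s hs))
      refine ⟨Matrix.nonneg_of_supersolution hA0 hv hAv fun s => ?_, hterm, fun s hs => ?_⟩
      · rw [hz s]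
        exact le_add_of_nonneg_right (hb0 s)
      · simp only [exp_reward_sub hη hΓ]
        rw [div_mul_eq_mul_div, eq_div_iff hΓ.ne', mul_comm, hz s, hin z hterm s hs]
  simp_rw [hiff, Matrix.resolvent_eq_iff hdet]
  exact existsUnique_eq

theorem Subcritical.exists_cutBellman (h : D.Subcritical η Γ sRef) :
    ∃ u, D.CutBellman η Γ sRef u := by
  classical
  obtain ⟨v, hv, hlt⟩ := h
  have hdet := Matrix.isUnit_det_of_supersolution cutKernel_nonneg hv hlt
  exact ⟨_, (Matrix.resolvent_eq_iff hdet _ _).2 rfl⟩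

theorem Subcritical.solvesBase (h : D.Subcritical η Γ sRef) (hη : 0 < η) (hΓ : 0 < Γ) :
    D.SolvesBase η Γ (D.baseSolution η Γ) :=
  solvesBase_baseSolution fun j _ τ _ => (h.existsUnique_base hη hΓ j τ).exists

open scoped Classical in
/-- In the subcritical case the exit system is solved by the solution of the cut problem. -/
theorem Subcritical.isExitSolution (h : D.Subcritical η Γ sRef) (hη : 0 < η) (hΓ : 0 < Γ)
    (hRef : sRef ∈ D.exits) {u : S → ℝ} (hu : D.CutBellman η Γ sRef u) :
    D.IsExitSolution η sRef Γ fun s => if s.1 = sRef then 1 else u s.1 := by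
  have hbase := h.solvesBase hη hΓ
  set w : D.exits → ℝ := fun s => if s.1 = sRef then 1 else u s.1 with hw
  set e : D.Estimate := ⟨Γ, D.baseSolution η Γ, w⟩ with he
  -- Both functions solve the block problems with the boundary values `w`, and these have only one
  -- solution.
  have hcomp : e.compose = u := by
    obtain ⟨v, hv, hlt⟩ := h.blockKernel
    have hdet := Matrix.isUnit_det_of_supersolution blockKernel_nonneg hv hlt
    have key : ∀ x : S → ℝ, (∀ s, Γ * x s = ∑ s', L.kernel η s s' *
        (if D.part s' = D.part s then x s' else D.extend w s')) →
        x = (Γ • (1 : Matrix S S ℝ) - D.blockKernel η)⁻¹.mulVec fun s => ∑ s', L.kernel η s s' *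
          (if D.part s' = D.part s then 0 else D.extend w s') := by
      intro x hx
      refine (Matrix.resolvent_eq_iff hdet _ _).1 fun s => ?_
      rw [hx s]
      simp only [Matrix.mulVec, dotProduct, Decomposition.blockKernel]
      rw [← Finset.sum_add_distrib]
      refine Finset.sum_congr rfl fun s' _ => ?_
      split_ifs <;> simp
    rw [key _ (compose_bellman (e := e) hbase hη hΓ), ← key u]
    intro s
    rw [hu s, sum_kernel_ite]
    · rw [extend_of_mem _ hRef]
      exact if_pos rfl
    · intro t ht hne
      rw [extend_of_mem _ ht]
      exact if_neg hne
  refine ⟨fun s => ?_, fun s hs => if_pos hs, fun s hs => ?_⟩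
  · simp only [hw]
    split_ifs
    exacts [zero_le_one, h.cutBellman_nonneg hu s.1]
  · rw [G_mulVec_eq, ← he, hcomp]
    exact if_neg hs

open scoped Classical in
theorem Subcritical.eq_of_isExitSolution (h : D.Subcritical η Γ sRef) (hη : 0 < η) (hΓ : 0 < Γ)
    (hRef : sRef ∈ D.exits) {u : S → ℝ} (hu : D.CutBellman η Γ sRef u) {w : D.exits → ℝ}
    (hw : D.IsExitSolution η sRef Γ w) :
    (Estimate.mk Γ (D.baseSolution η Γ) w : D.Estimate).compose = u ∧
      w = fun s => if s.1 = sRef then 1 else u s.1 := by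
  have h1 := h.cutBellman_unique (hw.cutBellman (h.solvesBase hη hΓ) hη hΓ hRef) hu
  refine ⟨h1, funext fun s => ?_⟩
  split_ifs with hs
  · exact hw.ref s hs
  · rw [← h1, hw.compose_eq s.2 hs]

theorem Subcritical.solvable (h : D.Subcritical η Γ sRef) (hη : 0 < η) (hΓ : 0 < Γ)
    (hRef : sRef ∈ D.exits) : D.Solvable η sRef Γ := by
  obtain ⟨u, hu⟩ := h.exists_cutBellman
  exact ⟨fun j _ τ _ => h.existsUnique_base hη hΓ j τ, _, h.isExitSolution hη hΓ hRef hu,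
    fun w hw => (h.eq_of_isExitSolution hη hΓ hRef hu hw).2⟩

theorem Solvable.isExitSolution (h : D.Solvable η sRef Γ) :
    D.IsExitSolution η sRef Γ (D.solve η sRef Γ).zE :=
  Classical.epsilon_spec h.2.exists

theorem Solvable.solvesBase (h : D.Solvable η sRef Γ) :
    D.SolvesBase η Γ (D.baseSolution η Γ) :=
  solvesBase_baseSolution fun j hj τ hτ => (h.1 j hj τ hτ).exists

theorem Solvable.cutBellman (h : D.Solvable η sRef Γ) (hη : 0 < η) (hΓ : 0 < Γ)
    (hRef : sRef ∈ D.exits) : D.CutBellman η Γ sRef (D.solve η sRef Γ).compose :=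
  h.isExitSolution.cutBellman h.solvesBase hη hΓ hRef

open scoped Classical in
-- Stored and composed values can differ only at `sRef`, the one exit where the system imposes no
-- equation.
theorem Solvable.value_eq (h : D.Solvable η sRef Γ) (hRef : sRef ∈ D.exits) (s : S) :
    (D.solve η sRef Γ).value s = (D.solve η sRef Γ).compose s +
      if s = sRef then 1 - (D.solve η sRef Γ).compose sRef else 0 := by
  rw [Estimate.value]
  split_ifs with hs hs' hs'
  · rw [h.isExitSolution.ref _ hs', hs']
    ring
  · rw [add_zero]
    exact (h.isExitSolution.compose_eq hs hs').symm
  · exact absurd (hs' ▸ hRef) hs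
  · rw [add_zero]

/-- The cut leaves the row of `sRef` intact, as it removes only transitions from other blocks. -/
theorem CutBellman.apply_sRef {u : S → ℝ} (hu : D.CutBellman η Γ sRef u) :
    (L.kernel η).mulVec u sRef = Γ * u sRef := by
  rw [hu sRef, kernel_mulVec_eq (D := D) (sRef := sRef), inflow_self, zero_mul]

/-- The tested value function is the composed one plus a spike of height 1 - u(s*) at `sRef`. The
composed part satisfies the tested relation with equality, so only the spike counts. -/
theorem Solvable.tooLarge_iff (h : D.Solvable η sRef Γ) (hη : 0 < η) (hΓ : 0 < Γ)
    (hRef : sRef ∈ D.exits) :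
    TooLarge η sRef (D.solve η sRef Γ) ↔
      0 < (Γ - L.kernel η sRef sRef) * (1 - (D.solve η sRef Γ).compose sRef) := by
  classical
  set u := (D.solve η sRef Γ).compose with hu
  have hval : (D.solve η sRef Γ).value = u + Pi.single sRef (1 - u sRef) := by
    funext s
    rw [h.value_eq hRef, Pi.add_apply, Pi.single_apply]
  have hgain : (D.solve η sRef Γ).gain = Γ := rfl
  rw [TooLarge, ← kernel_mulVec, hval, Matrix.mulVec_add, Pi.add_apply, Pi.add_apply,
    (h.cutBellman hη hΓ hRef).apply_sRef, Matrix.mulVec_single, hgain, Pi.single_eq_same]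
  simp only [Pi.smul_apply, Matrix.col_apply, MulOpposite.smul_eq_mul_unop, MulOpposite.unop_op]
  constructor <;> intro h1 <;> nlinarith

/-- The test of the binary search is correct, by duality with the left eigenvector `y`. -/
theorem Solvable.tooLarge_iff_lt (h : D.Solvable η sRef Γ) (hη : 0 < η) (hΓ : 0 < Γ)
    (hRef : sRef ∈ D.exits) {r : ℝ} {y : S → ℝ} (hy : ∀ s, 0 < y s)
    (hyr : ∀ x : S → ℝ, ∑ s, y s * (L.kernel η).mulVec x s = r * ∑ s, y s * x s) :
    TooLarge η sRef (D.solve η sRef Γ) ↔ r < Γ := by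
  classical
  rw [h.tooLarge_iff hη hΓ hRef]
  have hcut := h.cutBellman hη hΓ hRef
  have hu0 := compose_nonneg (e := D.solve η sRef Γ) h.solvesBase h.isExitSolution.nonneg
  set u := (D.solve η sRef Γ).compose with hu
  set Y := ∑ s, y s * u s with hY
  set K := ∑ s, y s * D.inflow η sRef s with hK
  have hY0 : 0 ≤ Y := Finset.sum_nonneg fun s _ => mul_nonneg (hy s).le (hu0 s)
  have hYu : y sRef * u sRef ≤ Y := Finset.single_le_sum (f := fun s => y s * u s)
    (fun s _ => mul_nonneg (hy s).le (hu0 s)) (Finset.mem_univ sRef)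
  have hK0 : 0 < K := by
    obtain ⟨s, hs, hpos⟩ := exists_pos_of_mem_exits (η := η) hRef
    refine Finset.sum_pos' (fun s _ => mul_nonneg (hy s).le (inflow_nonneg s))
      ⟨s, Finset.mem_univ s, mul_pos (hy s) ?_⟩
    rwa [inflow, if_pos hs]
  -- The cut equation paired with the left eigenvector.
  have hid : (Γ - r) * Y = (1 - u sRef) * K := by
    have h1 := hyr u
    have h2 : ∀ s, y s * (L.kernel η).mulVec u s =
        Γ * (y s * u s) - (1 - u sRef) * (y s * D.inflow η sRef s) := fun s => by
      rw [kernel_mulVec_eq (D := D) (sRef := sRef)]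
      linear_combination -(y s) * hcut s
    rw [Finset.sum_congr rfl fun s _ => h2 s, Finset.sum_sub_distrib, ← Finset.mul_sum,
      ← Finset.mul_sum] at h1
    linear_combination h1
  have hdiag : ∀ x : S → ℝ, (∀ s, 0 ≤ x s) →
      L.kernel η sRef sRef * x sRef ≤ (L.kernel η).mulVec x sRef := fun x hx =>
    Finset.single_le_sum (f := fun s => L.kernel η sRef s * x s)
      (fun s _ => mul_nonneg (L.kernel_nonneg η sRef s) (hx s)) (Finset.mem_univ sRef)
  constructor
  · intro hpos
    rcases lt_or_ge (u sRef) 1 with hlt | hge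
    · by_contra! hle
      have := mul_pos (sub_pos.2 hlt) hK0
      nlinarith
    · have h1 := hdiag u hu0
      rw [hcut.apply_sRef] at h1
      have h2 : L.kernel η sRef sRef ≤ Γ := le_of_mul_le_mul_right h1 (by linarith)
      nlinarith
  · intro hlt
    have hlt1 : u sRef < 1 := by
      by_contra! hge
      have h1 : 0 < Y := (mul_pos (hy sRef) (by linarith)).trans_le hYu
      have h2 := mul_pos (sub_pos.2 hlt) h1
      nlinarith
    -- A diagonal entry is at most the Perron eigenvalue: pair `y` with the kernel applied to the
    -- indicator of `sRef`.
    have hr : L.kernel η sRef sRef ≤ r := by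
      have h1 := hyr (Pi.single sRef 1)
      have h3 : ∀ s, 0 ≤ (Pi.single sRef (1 : ℝ) : S → ℝ) s := fun s => by
        rw [Pi.single_apply]
        split_ifs <;> norm_num
      have h2 : y sRef * (L.kernel η).mulVec (Pi.single sRef 1) sRef ≤
          ∑ s, y s * (L.kernel η).mulVec (Pi.single sRef 1) s :=
        Finset.single_le_sum (f := fun s => y s * (L.kernel η).mulVec (Pi.single sRef 1) s)
          (fun s _ => mul_nonneg (hy s).le
            (Matrix.mulVec_nonneg_of_nonneg (L.kernel_nonneg η) h3 s)) (Finset.mem_univ sRef)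
      rw [h1] at h2
      simp [Pi.single_apply] at h2
      exact le_of_mul_le_mul_left (by linarith) (hy sRef)
    exact mul_pos (by linarith) (by linarith)

end Decomposition

/-! ### Convergence at the optimal gain and the main theorem. -/

open Decomposition

variable {S ι : Type*} [Fintype S] {L : ALMDP S} {D : Decomposition L ι}
  {η ρ : ℝ} {sRef : S} {z : S → ℝ}

theorem IsOptimalValue.cutBellman (hz : L.IsOptimalValue η ρ sRef z) :
    D.CutBellman η (Real.exp (η * ρ)) sRef z := by
  intro s
  rw [← (bellman_iff L z s).1 (hz.bellman s), kernel_mulVec_eq (D := D) (sRef := sRef), hz.ref,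
    mul_one]

theorem IsOptimalValue.subcritical [DecidableEq S] (hz : L.IsOptimalValue η ρ sRef z) (hL : L.Communicating)
    (hRef : sRef ∈ D.exits) : D.Subcritical η (Real.exp (η * ρ)) sRef := by
  obtain ⟨s, hs, hpos⟩ := exists_pos_of_mem_exits (η := η) hRef
  refine Matrix.exists_supersolution cutKernel_nonneg cutKernel_le (hL.kernel_irreducible η)
    (Real.exp_pos _) hz.pos (fun s => (bellman_iff L z s).1 (hz.bellman s)) (a := s) (b := sRef) ?_
  rwa [cutKernel, if_pos ⟨rfl, hs⟩]

theorem Decomposition.Subcritical.mono {Γ Γ' : ℝ} (h : D.Subcritical η Γ sRef) (hle : Γ ≤ Γ') :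
    D.Subcritical η Γ' sRef := by
  obtain ⟨v, hv, hlt⟩ := h
  exact ⟨v, hv, fun s => (hlt s).trans_le (mul_le_mul_of_nonneg_right hle (hv s).le)⟩

theorem Decomposition.Subcritical.eventually {Γ : ℝ} (h : D.Subcritical η Γ sRef) :
    ∀ᶠ g in 𝓝 Γ, D.Subcritical η g sRef := by
  obtain ⟨v, hv, hlt⟩ := h
  have : ∀ᶠ g in 𝓝 Γ, ∀ s, (D.cutKernel η sRef).mulVec v s < g * v s :=
    eventually_all.2 fun s => ContinuousAt.eventually_lt continuousAt_const
      (by fun_prop) (hlt s)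
  exact this.mono fun g hg => ⟨v, hv, hg⟩

open scoped Classical in
/-- The solutions computed by the algorithm depend continuously on the gain estimate. -/
theorem IsOptimalValue.tendsto_solve (hz : L.IsOptimalValue η ρ sRef z) (hη : 0 < η)
    (hsub : D.Subcritical η (Real.exp (η * ρ)) sRef) (hRef : sRef ∈ D.exits) :
    (∀ s : S, Tendsto (fun g => (D.solve η sRef g).compose s) (𝓝 (Real.exp (η * ρ))) (𝓝 (z s))) ∧
      ∀ τ : D.exits, Tendsto (fun g => (D.solve η sRef g).zE τ) (𝓝 (Real.exp (η * ρ)))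
        (𝓝 (z τ.1)) := by
  -- A resolvent formula whose continuity at Γ is available; the chosen solutions agree with it near
  -- Γ.
  set W : ℝ → S → ℝ := fun g =>
    (g • (1 : Matrix S S ℝ) - D.cutKernel η sRef)⁻¹.mulVec (D.inflow η sRef) with hW
  have hWg : ∀ g, D.Subcritical η g sRef → D.CutBellman η g sRef (W g) := by
    rintro g ⟨v, hv, hlt⟩
    exact (Matrix.resolvent_eq_iff
      (Matrix.isUnit_det_of_supersolution cutKernel_nonneg hv hlt) _ _).2 rfl
  have hWz : W (Real.exp (η * ρ)) = z := hsub.cutBellman_unique (hWg _ hsub) hz.cutBellman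
  have hlim : Tendsto W (𝓝 (Real.exp (η * ρ))) (𝓝 z) := by
    obtain ⟨v, hv, hlt⟩ := hsub
    have h : Tendsto W (𝓝 (Real.exp (η * ρ))) (𝓝 (W (Real.exp (η * ρ)))) :=
      Matrix.continuousAt_resolvent_mulVec
        (Matrix.isUnit_det_of_supersolution cutKernel_nonneg hv hlt) (D.inflow η sRef)
    rwa [hWz] at h
  have hev : ∀ᶠ g in 𝓝 (Real.exp (η * ρ)), (D.solve η sRef g).compose = W g ∧
      (D.solve η sRef g).zE = fun s => if s.1 = sRef then 1 else W g s.1 := by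
    filter_upwards [hsub.eventually, lt_mem_nhds (Real.exp_pos (η * ρ))] with g hg hg0
    exact hg.eq_of_isExitSolution hη hg0 hRef (hWg g hg)
      (hg.solvable hη hg0 hRef).isExitSolution
  have hlim' := tendsto_pi_nhds.1 hlim
  refine ⟨fun s => (hlim' s).congr' (hev.mono fun g hg => (congrFun hg.1 s).symm), fun τ => ?_⟩
  by_cases hτ : τ.1 = sRef
  · rw [hτ, hz.ref]
    refine tendsto_const_nhds.congr' (hev.mono fun g hg =>
      ((congrFun hg.2 τ).trans (if_pos hτ)).symm)
  · refine (hlim' τ.1).congr' (hev.mono fun g hg =>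
      ((congrFun hg.2 τ).trans (if_neg hτ)).symm)

end ALMDP

theorem theorem2 {S ι : Type*} [Fintype S] [DecidableEq S]
    (L : ALMDP S) (hL : L.Communicating) (η : ℝ) (hη : 0 < η)
    (D : L.Decomposition ι) (sRef : S) (hRef : sRef ∈ D.exits) :
    ∃ (ρ : ℝ) (z : S → ℝ),
      L.IsOptimalGain η ρ ∧
      L.IsOptimalValue η ρ sRef z ∧
      (∀ z' : S → ℝ, L.IsOptimalValue η ρ sRef z' → z' = z) ∧
      ∀ h : ℝ, Real.exp (η * ρ) ≤ h →
        (∀ ε : ℝ, 0 < ε → ∃ σ : D.State,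
          (∀ σ' : D.State, D.HaltsIn η sRef h ε σ' ↔ σ' = σ) ∧
          σ.lo ≤ Real.exp (η * ρ) ∧ Real.exp (η * ρ) ≤ σ.hi ∧ σ.hi - σ.lo ≤ ε) ∧
        ∃ e : ℝ → D.Estimate,
          (∀ᶠ ε in 𝓝[>] (0 : ℝ), D.Returns η sRef h ε (e ε)) ∧
          Tendsto (fun ε => (e ε).gain) (𝓝[>] 0) (𝓝 (Real.exp (η * ρ))) ∧
          (∀ τ : D.exits, Tendsto (fun ε => (e ε).zE τ) (𝓝[>] 0) (𝓝 (z τ.1))) ∧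
          ∀ s : S, Tendsto (fun ε => (e ε).compose s) (𝓝[>] 0) (𝓝 (z s)) := by
  obtain ⟨ρ, z, y, hz, hy, hyr⟩ := hL.exists_eigenvectors hη sRef
  have hsub := hz.subcritical hL hRef
  have hΓ := Real.exp_pos (η * ρ)
  have hgt : ∀ g, Real.exp (η * ρ) ≤ g → D.Solvable η sRef g := fun g hg =>
    (hsub.mono hg).solvable hη (hΓ.trans_le hg) hRef
  have htest : ∀ g, 0 < g → D.Solvable η sRef g →
      (ALMDP.Decomposition.TooLarge η sRef (D.solve η sRef g) ↔ Real.exp (η * ρ) < g) :=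
    fun g hg hs => hs.tooLarge_iff_lt hη hg hRef hy hyr
  have hnear : ∀ᶠ g in 𝓝 (Real.exp (η * ρ)), D.Solvable η sRef g := by
    filter_upwards [hsub.eventually, lt_mem_nhds hΓ] with g hg hg0
    exact hg.solvable hη hg0 hRef
  refine ⟨ρ, z, hz.isOptimalGain hη, hz,
    -- The normalization at `sRef` makes every optimal value function a solution of the cut problem
    -- at Γ, which has only one.
    fun z' hz' => hsub.cutBellman_unique hz'.cutBellman hz.cutBellman,
    fun h hh => ⟨fun ε hε => ?_, ?_⟩⟩
  · obtain ⟨σ, hσ, hb, hw⟩ := ALMDP.Decomposition.exists_haltsIn_iff hΓ hgt htest hh hε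
    exact ⟨σ, hσ, hb.lo_le, hb.le_hi, hw⟩
  · obtain ⟨g, hg, hlim⟩ := ALMDP.Decomposition.exists_returns hΓ hgt htest hnear hh
    obtain ⟨h1, h2⟩ := hz.tendsto_solve hη hsub hRef
    exact ⟨fun ε => D.solve η sRef (g ε), hg, hlim, fun τ => (h2 τ).comp hlim,
      fun s => (h1 s).comp hlim⟩
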